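/- **Theorem 5.2.** Let $\psi:\mathbb R\to[0,1]$ be continuous and even, nonincreasing on $[0,\infty)$, with $\int_{\mathbb R}\psi(t)\,dt=1$ and $\int_{\mathbb R}\sqrt{\psi(t)}\,dt<\infty$, and let $v\ge 0$ and $M<\infty$. Then there are constants $C,n_0,b_0$, depending only on $v,\psi,M$, such that the following holds for all integers $n\ge\max(n_0,1)$ and all real $b>0$ with $b_0\le b\le N:=2n+1$. Let $a(i,j),d(i,j)$, $-n\le i\le j\le n$, be jointly independent real random variables on a probability space such that $\mathbf P\{d(i,j)=1\}=\psi\big(\tfrac{i-j}{b}\big)=1-\mathbf P\{d(i,j)=0\}$ and, for all $i\le j$, $$\mathbf E\,a(i,j)=\mathbf E\,a(i,j)^3=\mathbf E\,a(i,j)^5=0,\quad \mathbf E\,a(i,j)^2=v^2,\quad \mathbf E\,a(i,j)^4=3v^4,\quad \mathbf E\,a(i,j)^6=15v^6,\quad \mathbf E|a(i,j)|^{10}\le M.$$ Let $H$ be the real symmetric $N\times N$ matrix with rows and columns indexed by $\{-n,\dots,n\}$ and $H(i,j)=H(j,i)=b^{-1/2}a(i,j)d(i,j)$ for $i\le j$.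 For nonreal $z$ put $G(z)=(H-zI)^{-1}$ and $g_n(z)=\frac1N\sum_{|i|\le n}G(i,i;z)$; for a complex random variable $\zeta$ put $\zeta^0=\zeta-\mathbf E\zeta$ and $\mathbf{Var}\,\zeta=\mathbf E|\zeta^0|^2$. Then, for every $z\in\mathbb C$ with $|\operatorname{Im}z|\ge 2v+1$, $$\sup_{|i|\le n}\big|\mathbf E\{g_n^0(z)\,G^0(i,i;z)\}\big|\le C\Big(\frac1{nb}+\frac1b\sqrt{\mathbf{Var}\,g_n(z)}\Big)\qquad\text{and}\qquad \mathbf{Var}\,g_n(z)\le\frac{C}{b^2}.$$ -/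

import Mathlib

open MeasureTheory ProbabilityTheory
open scoped ENNReal NNReal

noncomputable section

namespace LongRangePercolation

/-- The index set `{i ∈ ℤ : |i| ≤ n}` of rows and columns; it has `N = 2 n + 1` elements. -/
abbrev Site (n : ℕ) : Type := ↥(Finset.Icc (-(n : ℤ)) (n : ℤ))

/-- The index pairs `(i, j)` with `i ≤ j` (entries on and above the diagonal). -/
abbrev Edge (n : ℕ) : Type := {e : Site n × Site n // e.1 ≤ e.2}

/-- The pair `i ≤ j` underlying the matrix position `(i, j)`, which may be given in any order. -/
def edge {n : ℕ} (i j : Site n) : Edge n := ⟨(min i j, max i j), min_le_max⟩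

/-- The connection profile: a continuous even function with values in `[0, 1]` and total
integral `1`, monotone (nonincreasing) on the half-line `[0, ∞)`. -/
structure IsProfile (ψ : ℝ → ℝ) : Prop where
  continuous : Continuous ψ
  even : ∀ t, ψ (-t) = ψ t
  antitoneOn : AntitoneOn ψ (Set.Ici 0)
  nonneg : ∀ t, 0 ≤ ψ t
  le_one : ∀ t, ψ t ≤ 1
  integral_eq_one : ∫ t, ψ t = 1

variable {Ω : Type*} [MeasurableSpace Ω]

/-- The random variables behind the long-range percolation matrix of size `2 n + 1` with band
parameter `b`: the amplitudes `a (i, j)` are centred with variance `v ^ 2`, the variables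
`d (i, j)` are Bernoulli with success probability `ψ ((i - j) / b)`, and all the variables
`a (i, j)`, `d (i, j)`, `i ≤ j`, are jointly independent (so `a` is an independent family, `d` is
an independent family, and the two families are independent of each other). -/
structure IsEnsemble {n : ℕ} (b v : ℝ) (ψ : ℝ → ℝ) (μ : Measure Ω) (a d : Edge n → Ω → ℝ) :
    Prop where
  measurable_a : ∀ e, Measurable (a e)
  measurable_d : ∀ e, Measurable (d e)
  indep : iIndepFun (Sum.elim a d) μ
  d_one : ∀ e : Edge n, μ {ω | d e ω = 1} =
    ENNReal.ofReal (ψ (((e.1.1 : ℤ) - (e.1.2 : ℤ) : ℝ) / b))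
  d_zero : ∀ e : Edge n, μ {ω | d e ω = 0} =
    ENNReal.ofReal (1 - ψ (((e.1.1 : ℤ) - (e.1.2 : ℤ) : ℝ) / b))
  mean_a : ∀ e, ∫ ω, a e ω ∂μ = 0
  variance_a : ∀ e, ∫ ω, a e ω ^ 2 ∂μ = v ^ 2

/-- The supremum over `i ≤ j` of the absolute moments `E |a (i, j)| ^ r`, in `[0, ∞]`. -/
def absMomentSup {n : ℕ} (μ : Measure Ω) (a : Edge n → Ω → ℝ) (r : ℕ) : ℝ≥0∞ :=
  ⨆ e, ∫⁻ ω, ‖a e ω‖ₑ ^ r ∂μ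

/-- The random real symmetric matrix `H (i, j) = b ^ (-1/2) a (i, j) d (i, j)`. -/
def hMatrix {n : ℕ} (b : ℝ) (a d : Edge n → Ω → ℝ) (ω : Ω) : Matrix (Site n) (Site n) ℝ :=
  Matrix.of fun i j => (Real.sqrt b)⁻¹ * a (edge i j) ω * d (edge i j) ω

/-- The resolvent `G (z) = (H - z I)⁻¹`. -/
def resolvent {n : ℕ} (b : ℝ) (a d : Edge n → Ω → ℝ) (z : ℂ) (ω : Ω) :
    Matrix (Site n) (Site n) ℂ :=
  ((hMatrix b a d ω).map (fun x : ℝ => (x : ℂ)) - z • (1 : Matrix (Site n) (Site n) ℂ))⁻¹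

/-- The normalized trace `g_n (z) = N⁻¹ ∑ i, G (i, i)` of the resolvent, `N = 2 n + 1`. -/
def normTrace {n : ℕ} (b : ℝ) (a d : Edge n → Ω → ℝ) (z : ℂ) (ω : Ω) : ℂ :=
  (2 * (n : ℂ) + 1)⁻¹ * ∑ i : Site n, resolvent b a d z ω i i

/-- The centred variable `X⁰ = X - E X`. -/
def centred (μ : Measure Ω) (X : Ω → ℂ) (ω : Ω) : ℂ := X ω - ∫ ω', X ω' ∂μ

/-- The variance `E |X - E X| ^ 2` of a complex random variable. -/
def cVar (μ : Measure Ω) (X : Ω → ℂ) : ℝ := ∫ ω, ‖centred μ X ω‖ ^ 2 ∂μ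

end LongRangePercolation

end

set_option linter.unusedSectionVars false

/-! The entries on and above the diagonal are independent, so the joint law of the matrix is a
product measure on `Edge n → ℝ`, and both bounds are proved there.

Variance. For weights `0 ≤ D s ≤ 1` let `F = ∑ D s * G s s`. By Efron–Stein (`efron_stein`) the
variance of `F` is at most the sum over edges of the mean squared change caused by setting one entry
to `0`. To first order the change is the entry times an off-diagonal element of `G D G`. The squares
of these elements add up to at most a multiple of `∑ D s` (a Hilbert–Schmidt bound), and each entry
has variance at most `v ^ 2 / b`. The quadratic remainder has coefficients of size `p e / b ^ 2`,
where `p e` is the connection probability, and the row sums of `p` are of order `b`. Hence `Var F ≤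
(A / b) * ∑ D s` (`variance_weightedTrace_le`). With `D = 1` this gives `Var g ≤ A / (b N)`, which
is at most `A / b ^ 2` because `b ≤ N`.

Covariance. Put `Y = E (g⁰ * G i i)`. The identity `1 + z * G i i = ∑ H i s * G s i`, multiplied by
`g⁰` and integrated, gives `z * Y = ∑ E (H i s * g⁰ * G s i)`. Integration by parts in each entry
(`norm_integral_coord_mul_sub_le`) uses that the first and third moments vanish; its error is of
fourth-moment size. Up to terms of order `(√V + 1/N) / b`, with `V = Var g`, the result is `-(v ^ 2
/ b) * E (g⁰ * G i i * F)`, where `F` is the local average with weights `p (edge i s)`. By the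
variance bound `F` has bounded variance, so replacing it by its mean `f` costs a further `√V / b`,
by Cauchy–Schwarz. The remaining term `(v ^ 2 / b) * f * Y` is at most `(|Im z| / 2) * ‖Y‖`, because
`|Im z| ≥ 2 v`, and is absorbed by `z * Y`. -/

namespace LongRangePercolation

/-! ### Product measures: integrating out one coordinate, and the Efron–Stein inequality -/

section ProductMeasure

variable {ι : Type*} [Fintype ι] [DecidableEq ι] (ρ : ι → Measure ℝ)
  [∀ e, IsProbabilityMeasure (ρ e)]

theorem measurable_update_pair (e : ι) :
    Measurable (fun p : (ι → ℝ) × ℝ => Function.update p.1 e p.2) := by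
  rw [measurable_pi_iff]
  intro f
  by_cases h : f = e
  · subst h
    simpa using measurable_snd
  · simp only [Function.update_of_ne h]
    exact (measurable_pi_apply f).comp measurable_fst

/-- Replacing one coordinate by an independent copy does not change the law. This serves as Fubini
for a single coordinate without splitting the index set, and every one-coordinate integration below
rests on it. -/
theorem measurePreserving_update (e : ι) :
    MeasurePreserving (fun p : (ι → ℝ) × ℝ => Function.update p.1 e p.2)
      ((Measure.pi ρ).prod (ρ e)) (Measure.pi ρ) := by
  refine ⟨measurable_update_pair e, ?_⟩
  symm
  refine Measure.pi_eq fun s hs => ?_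
  rw [Measure.map_apply (measurable_update_pair e) (MeasurableSet.univ_pi hs)]
  have : (fun p : (ι → ℝ) × ℝ => Function.update p.1 e p.2) ⁻¹' (Set.univ.pi s) =
      (Set.univ.pi (Function.update s e Set.univ)) ×ˢ (s e) := by
    ext p
    simp only [Set.mem_preimage, Set.mem_pi, Set.mem_univ, forall_const, Set.mem_prod]
    constructor
    · intro h
      refine ⟨fun f => ?_, by simpa using h e⟩
      by_cases hf : f = e
      · subst hf; simp
      · simpa [Function.update_of_ne hf] using h f
    · rintro ⟨h, h'⟩ f
      by_cases hf : f = e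
      · subst hf; simpa using h'
      · simpa [Function.update_of_ne hf] using h f
  rw [this, Measure.prod_prod, Measure.pi_pi]
  rw [← Finset.mul_prod_erase _ _ (Finset.mem_univ e), ← Finset.mul_prod_erase Finset.univ
    (fun i => ρ i (s i)) (Finset.mem_univ e), mul_comm]
  simp only [Function.update_self, measure_univ, one_mul]
  congr 1
  refine Finset.prod_congr rfl fun f hf => ?_
  rw [Function.update_of_ne (Finset.ne_of_mem_erase hf)]

variable {E : Type*} [NormedAddCommGroup E] [NormedSpace ℝ E]

theorem integrable_of_measurable_of_bound {α : Type*} [MeasurableSpace α] {μ : Measure α}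
    [IsFiniteMeasure μ] {F : α → ℂ} (hF : Measurable F) {C : ℝ} (hC : ∀ x, ‖F x‖ ≤ C) :
    Integrable F μ :=
  Integrable.of_bound hF.aestronglyMeasurable C (Filter.Eventually.of_forall hC)

theorem integral_eq_integral_update (e : ι) {F : (ι → ℝ) → E}
    (hF : Integrable F (Measure.pi ρ)) :
    ∫ x, F x ∂(Measure.pi ρ) = ∫ x, ∫ y, F (Function.update x e y) ∂(ρ e) ∂(Measure.pi ρ) := by
  have hmp := measurePreserving_update ρ e
  have h1 : Integrable (fun p : (ι → ℝ) × ℝ => F (Function.update p.1 e p.2))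
      ((Measure.pi ρ).prod (ρ e)) := hmp.integrable_comp_of_integrable hF
  rw [← integral_prod _ h1]
  have h2 : AEStronglyMeasurable F (Measure.map (fun p : (ι → ℝ) × ℝ =>
      Function.update p.1 e p.2) ((Measure.pi ρ).prod (ρ e))) := by
    rw [hmp.map_eq]; exact hF.aestronglyMeasurable
  rw [← integral_map hmp.measurable.aemeasurable h2, hmp.map_eq]

/-- A function of `x e` times a function of the remaining coordinates is integrable. -/
theorem integrable_mul_update {L : Type*} [RCLike L] (e : ι) {φ : ℝ → L} {K : (ι → ℝ) → L}
    (hφ : Integrable φ (ρ e))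
    (hK : Integrable (fun x => K (Function.update x e 0)) (Measure.pi ρ))
    (hφm : Measurable φ) (hKm : Measurable K) :
    Integrable (fun x => φ (x e) * K (Function.update x e 0)) (Measure.pi ρ) := by
  have hmp := measurePreserving_update ρ e
  have h1 := hK.mul_prod hφ
  rw [← hmp.map_eq, integrable_map_measure _ hmp.measurable.aemeasurable]
  · refine h1.congr (Filter.Eventually.of_forall fun p => ?_)
    simp [mul_comm]
  · refine Measurable.aestronglyMeasurable ?_
    refine (hφm.comp (measurable_pi_apply e)).mul (hKm.comp ?_)
    exact measurable_update_left

theorem integral_mul_update {L : Type*} [RCLike L] (e : ι) {φ : ℝ → L} {K : (ι → ℝ) → L}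
    (hφm : Measurable φ) (hKm : Measurable K) :
    ∫ x, φ (x e) * K (Function.update x e 0) ∂(Measure.pi ρ) =
      (∫ y, φ y ∂(ρ e)) * ∫ x, K (Function.update x e 0) ∂(Measure.pi ρ) := by
  have hmp := measurePreserving_update ρ e
  have hm : Measurable fun x : ι → ℝ => φ (x e) * K (Function.update x e 0) :=
    (hφm.comp (measurable_pi_apply e)).mul (hKm.comp measurable_update_left)
  have h2 : ∫ x, φ (x e) * K (Function.update x e 0) ∂(Measure.pi ρ) =
      ∫ p : (ι → ℝ) × ℝ, K (Function.update p.1 e 0) * φ p.2 ∂((Measure.pi ρ).prod (ρ e)) := by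
    rw [← hmp.map_eq, integral_map hmp.measurable.aemeasurable hm.aestronglyMeasurable]
    simp [mul_comm, hmp.map_eq]
  rw [h2, integral_prod_mul (fun x => K (Function.update x e 0)) φ, mul_comm]

/-- Integrating out the coordinate `e`. -/
noncomputable def average (e : ι) (F : (ι → ℝ) → ℂ) (x : ι → ℝ) : ℂ :=
  ∫ y, F (Function.update x e y) ∂(ρ e)

/-- Bounded measurable functions. -/
def BoundedMeasurable {α : Type*} [MeasurableSpace α] (F : α → ℂ) : Prop :=
  Measurable F ∧ ∃ C, ∀ x, ‖F x‖ ≤ C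

namespace BoundedMeasurable
variable {α : Type*} [MeasurableSpace α] {F G : α → ℂ}

theorem integrable {μ : Measure α} [IsFiniteMeasure μ] (hF : BoundedMeasurable F) :
    Integrable F μ :=
  let ⟨_, hC⟩ := hF.2
  integrable_of_measurable_of_bound hF.1 hC

theorem integrable_sq {μ : Measure α} [IsFiniteMeasure μ] (hF : BoundedMeasurable F) :
    Integrable (fun x => ‖F x‖ ^ 2) μ := by
  obtain ⟨C, hC⟩ := hF.2
  refine Integrable.of_bound (hF.1.norm.pow_const 2).aestronglyMeasurable (C ^ 2)
    (Filter.Eventually.of_forall fun x => ?_)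
  rw [norm_pow, norm_norm]
  exact pow_le_pow_left₀ (norm_nonneg _) (hC x) 2

theorem add (hF : BoundedMeasurable F) (hG : BoundedMeasurable G) :
    BoundedMeasurable (fun x => F x + G x) := by
  obtain ⟨C, hC⟩ := hF.2
  obtain ⟨D, hD⟩ := hG.2
  exact ⟨hF.1.add hG.1, C + D, fun x => (norm_add_le _ _).trans (add_le_add (hC x) (hD x))⟩

theorem sub (hF : BoundedMeasurable F) (hG : BoundedMeasurable G) :
    BoundedMeasurable (fun x => F x - G x) := by
  obtain ⟨C, hC⟩ := hF.2
  obtain ⟨D, hD⟩ := hG.2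
  exact ⟨hF.1.sub hG.1, C + D, fun x => (norm_sub_le _ _).trans (add_le_add (hC x) (hD x))⟩

theorem mul (hF : BoundedMeasurable F) (hG : BoundedMeasurable G) :
    BoundedMeasurable (fun x => F x * G x) := by
  obtain ⟨C, hC⟩ := hF.2
  obtain ⟨D, hD⟩ := hG.2
  refine ⟨hF.1.mul hG.1, C * D, fun x => ?_⟩
  rw [norm_mul]
  exact mul_le_mul (hC x) (hD x) (norm_nonneg _) ((norm_nonneg _).trans (hC x))

theorem const (c : ℂ) : BoundedMeasurable (fun _ : α => c) :=
  ⟨measurable_const, ‖c‖, fun _ => le_rfl⟩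

theorem comp {β : Type*} [MeasurableSpace β] {f : β → α} (hF : BoundedMeasurable F)
    (hf : Measurable f) : BoundedMeasurable (fun x => F (f x)) :=
  let ⟨C, hC⟩ := hF.2
  ⟨hF.1.comp hf, C, fun x => hC (f x)⟩

theorem sum {κ : Type*} (s : Finset κ) {F : κ → α → ℂ}
    (hF : ∀ k ∈ s, BoundedMeasurable (F k)) :
    BoundedMeasurable (fun x => ∑ k ∈ s, F k x) := by
  classical
  induction s using Finset.induction_on with
  | empty => simpa using const (α := α) 0
  | insert a s ha ih =>
    simp only [Finset.sum_insert ha]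
    exact (hF a (Finset.mem_insert_self _ _)).add
      (ih fun k hk => hF k (Finset.mem_insert_of_mem hk))

end BoundedMeasurable

theorem BoundedMeasurable.average {F : (ι → ℝ) → ℂ} (hF : BoundedMeasurable F) (e : ι) :
    BoundedMeasurable (average ρ e F) := by
  obtain ⟨C, hC⟩ := hF.2
  constructor
  · have h : StronglyMeasurable (fun p : (ι → ℝ) × ℝ => F (Function.update p.1 e p.2)) :=
      (hF.1.comp (measurable_update_pair e)).stronglyMeasurable
    exact h.integral_prod_right.measurable
  · refine ⟨C, fun x => ?_⟩
    have := norm_integral_le_of_norm_le_const (μ := ρ e) (f := fun y => F (Function.update x e y))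
      (Filter.Eventually.of_forall fun y => hC _)
    simpa [LongRangePercolation.average] using this

/-- Pythagoras: the cross term is a constant times a centred variable, so its integral vanishes. -/
theorem integral_norm_sub_sq {α : Type*} [MeasurableSpace α] {μ : Measure α}
    [IsProbabilityMeasure μ] {f : α → ℂ} (hf : BoundedMeasurable f) (c : ℂ) :
    ∫ y, ‖f y - ∫ u, f u ∂μ + c‖ ^ 2 ∂μ = ∫ y, ‖f y - ∫ u, f u ∂μ‖ ^ 2 ∂μ + ‖c‖ ^ 2 := by
  set m := ∫ u, f u ∂μ with hm
  have h0 : BoundedMeasurable (fun y => f y - m) := hf.sub (.const m)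
  have h1 : ∀ y, ‖f y - m + c‖ ^ 2 =
      ‖f y - m‖ ^ 2 + ‖c‖ ^ 2 + 2 * (star c * (f y - m)).re := by
    intro y
    simp only [← Complex.normSq_eq_norm_sq, Complex.normSq_apply]
    simp
    ring
  have h2 : BoundedMeasurable (fun y => star c * (f y - m)) := (BoundedMeasurable.const _).mul h0
  have h3 : ∫ y, (star c * (f y - m)).re ∂μ = 0 := by
    have := integral_re (𝕜 := ℂ) (h2.integrable (μ := μ))
    simp only [RCLike.re_to_complex] at this
    rw [this, integral_const_mul, integral_sub hf.integrable (integrable_const _)]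
    simp [hm]
  simp_rw [h1]
  have h4 : Integrable (fun y => (star c * (f y - m)).re) μ := by
    simpa using (h2.integrable (μ := μ)).re
  rw [integral_add (f := fun y => ‖f y - m‖ ^ 2 + ‖c‖ ^ 2)
      (h0.integrable_sq.add (integrable_const _)) (h4.const_mul 2),
    integral_add h0.integrable_sq (integrable_const _), integral_const_mul, h3]
  simp

/-- Once the other coordinates are frozen, `K` is a constant and `average ρ e F` is a mean, so the
previous identity applies on each fibre. In effect `average ρ e` is an orthogonal projection. -/
theorem integral_norm_sub_average_add_sq {F K : (ι → ℝ) → ℂ} (hF : BoundedMeasurable F)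
    (hK : BoundedMeasurable K) (e : ι) (hKe : ∀ x y, K (Function.update x e y) = K x) :
    ∫ x, ‖F x - average ρ e F x + K x‖ ^ 2 ∂(Measure.pi ρ) =
      ∫ x, ‖F x - average ρ e F x‖ ^ 2 ∂(Measure.pi ρ) + ∫ x, ‖K x‖ ^ 2 ∂(Measure.pi ρ) := by
  have hA := hF.average ρ e
  have hAe : ∀ x y, average ρ e F (Function.update x e y) = average ρ e F x := by
    intro x y; simp [average]
  rw [integral_eq_integral_update ρ e ((hF.sub hA).add hK).integrable_sq,
    integral_eq_integral_update ρ e (hF.sub hA).integrable_sq, ← integral_add]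
  · congr 1
    ext x
    simp only [hAe, hKe]
    exact integral_norm_sub_sq (hF.comp (measurable_update x)) _
  · have h1 := (measurePreserving_update ρ e).integrable_comp_of_integrable
      (hF.sub hA).integrable_sq
    exact h1.integral_prod_left
  · exact hK.integrable_sq

/-- Integrating out a list of coordinates. -/
noncomputable def averageList (F : (ι → ℝ) → ℂ) : List ι → (ι → ℝ) → ℂ
  | [] => F
  | e :: l => average ρ e (averageList F l)

theorem BoundedMeasurable.averageList {F : (ι → ℝ) → ℂ} (hF : BoundedMeasurable F)
    (l : List ι) : BoundedMeasurable (averageList ρ F l) := by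
  induction l with
  | nil => exact hF
  | cons e l ih => exact ih.average ρ e

theorem averageList_update {F : (ι → ℝ) → ℂ} {l : List ι} {e : ι} (he : e ∈ l) (x : ι → ℝ)
    (y : ℝ) : averageList ρ F l (Function.update x e y) = averageList ρ F l x := by
  induction l generalizing x with
  | nil => simp at he
  | cons f l ih =>
    simp only [averageList, average]
    by_cases hf : e = f
    · subst hf; simp
    · have he' : e ∈ l := by simpa [hf] using he
      congr 1
      ext u
      rw [Function.update_comm hf, ih he']

theorem averageList_sub (F : (ι → ℝ) → ℂ) (hF : BoundedMeasurable F) (l : List ι) (e : ι)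
    (x : ι → ℝ) : averageList ρ F (e :: l) x =
      average ρ e F x - average ρ e (fun u => F u - averageList ρ F l u) x := by
  simp only [averageList, average]
  have hu : Measurable (fun y => Function.update x e y) := measurable_update x
  rw [integral_sub (hF.comp hu).integrable ((hF.averageList ρ l).comp hu).integrable]
  ring

/-- Tensorization of the variance. `F - averageList ρ F (e :: l)` is the sum of `F - average ρ e F`
and the `e`-average of `F - averageList ρ F l`. The two are orthogonal, and averaging does not
increase the second norm. -/
theorem integral_norm_sub_averageList_sq_le {F : (ι → ℝ) → ℂ} (hF : BoundedMeasurable F)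
    (l : List ι) :
    ∫ x, ‖F x - averageList ρ F l x‖ ^ 2 ∂(Measure.pi ρ) ≤
      (l.map fun e => ∫ x, ‖F x - average ρ e F x‖ ^ 2 ∂(Measure.pi ρ)).sum := by
  induction l with
  | nil => simp [averageList]
  | cons e l ih =>
    have hD : BoundedMeasurable (fun u => F u - averageList ρ F l u) :=
      hF.sub (hF.averageList ρ l)
    have hAe : ∀ (G : (ι → ℝ) → ℂ) x y,
        average ρ e G (Function.update x e y) = average ρ e G x := by
      intro G x y; simp [average]
    have h1 := integral_norm_sub_average_add_sq ρ hF (hD.average ρ e) e (hAe _)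
    have h2 := integral_norm_sub_average_add_sq ρ hD (hD.average ρ e) e (hAe _)
    have h3 : ∀ x, F x - averageList ρ F (e :: l) x =
        F x - average ρ e F x + average ρ e (fun u => F u - averageList ρ F l u) x := by
      intro x; rw [averageList_sub ρ F hF]; ring
    simp_rw [h3, h1, List.map_cons, List.sum_cons]
    simp only [sub_add_cancel] at h2
    have : 0 ≤ ∫ x, ‖F x - averageList ρ F l x -
        average ρ e (fun u => F u - averageList ρ F l u) x‖ ^ 2 ∂(Measure.pi ρ) :=
      integral_nonneg fun x => by positivity
    linarith

theorem eq_of_forall_update {F : (ι → ℝ) → ℂ} (h : ∀ e x y, F (Function.update x e y) = F x)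
    (x x' : ι → ℝ) : F x = F x' := by
  have key : ∀ s : Finset ι, F (s.piecewise x x') = F x' := by
    intro s
    induction s using Finset.induction_on with
    | empty => simp
    | insert a s ha ih => rw [Finset.piecewise_insert, h, ih]
  simpa using key Finset.univ

/-- The Efron–Stein inequality, with the value `0` substituted for the removed coordinate. -/
theorem efron_stein {F : (ι → ℝ) → ℂ} (hF : BoundedMeasurable F) :
    ∫ x, ‖F x - ∫ u, F u ∂(Measure.pi ρ)‖ ^ 2 ∂(Measure.pi ρ) ≤
      ∑ e, ∫ x, ‖F x - F (Function.update x e 0)‖ ^ 2 ∂(Measure.pi ρ) := by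
  have h1 := integral_norm_sub_averageList_sq_le ρ hF Finset.univ.toList
  set A := averageList ρ F Finset.univ.toList with hA
  -- Averaging over every coordinate leaves a constant.
  have hconst : ∀ x, A x = A 0 := fun x =>
    eq_of_forall_update (fun e x y => averageList_update ρ (by simp) x y) x 0
  -- Among constants the mean minimises the quadratic distance to `F`, so it is never necessary to
  -- identify `A 0` with the mean.
  have h2 := integral_norm_sub_sq (μ := Measure.pi ρ) hF (∫ u, F u ∂(Measure.pi ρ) - A 0)
  simp only [sub_add_sub_cancel] at h2
  simp_rw [hconst] at h1
  -- Among functions not depending on `x e`, the average is the closest to `F`; substituting `0` is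
  -- one competitor.
  have h3 : ∀ e, ∫ x, ‖F x - average ρ e F x‖ ^ 2 ∂(Measure.pi ρ) ≤
      ∫ x, ‖F x - F (Function.update x e 0)‖ ^ 2 ∂(Measure.pi ρ) := by
    intro e
    have hK : BoundedMeasurable (fun x => average ρ e F x - F (Function.update x e 0)) :=
      (hF.average ρ e).sub (hF.comp measurable_update_left)
    have := integral_norm_sub_average_add_sq ρ hF hK e (by intro x y; simp [average])
    simp only [sub_add_sub_cancel] at this
    rw [this]
    have : 0 ≤ ∫ x, ‖average ρ e F x - F (Function.update x e 0)‖ ^ 2 ∂(Measure.pi ρ) :=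
      integral_nonneg fun x => by positivity
    linarith
  rw [Finset.sum_map_toList] at h1
  have h4 := Finset.sum_le_sum fun e (_ : e ∈ Finset.univ) => h3 e
  have : 0 ≤ ‖∫ u, F u ∂(Measure.pi ρ) - A 0‖ ^ 2 := by positivity
  linarith

end ProductMeasure

open scoped Matrix.Norms.L2Operator

/-! ### Operator norm: row and column sums, Hilbert–Schmidt bounds, resolvents of Hermitian matrices
-/

section MatrixNorm

variable {V : Type*} [Fintype V] [DecidableEq V]

theorem sum_norm_mulVec_sq_le (A : Matrix V V ℂ) (v : V → ℂ) :
    ∑ i, ‖(A.mulVec v) i‖ ^ 2 ≤ ‖A‖ ^ 2 * ∑ i, ‖v i‖ ^ 2 := by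
  have h := (Matrix.toEuclideanCLM (n := V) (𝕜 := ℂ) A).le_opNorm (WithLp.toLp 2 v)
  rw [Matrix.l2_opNorm_toEuclideanCLM] at h
  have h2 := pow_le_pow_left₀ (norm_nonneg _) h 2
  rw [mul_pow, EuclideanSpace.norm_sq_eq, EuclideanSpace.norm_sq_eq] at h2
  simpa using h2

theorem sum_norm_col_sq_le (A : Matrix V V ℂ) (j : V) :
    ∑ s, ‖A s j‖ ^ 2 ≤ ‖A‖ ^ 2 := by
  have h := sum_norm_mulVec_sq_le A (Pi.single j 1)
  rw [Matrix.mulVec_single_one] at h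
  have : ∑ i, ‖(Pi.single j 1 : V → ℂ) i‖ ^ 2 = 1 := by
    rw [Finset.sum_eq_single j] <;> simp +contextual
  rw [this, mul_one] at h
  simpa [Matrix.col] using h

theorem norm_entry_le (A : Matrix V V ℂ) (i j : V) : ‖A i j‖ ≤ ‖A‖ := by
  have h1 : ‖A i j‖ ^ 2 ≤ ‖A‖ ^ 2 :=
    (Finset.single_le_sum (f := fun s => ‖A s j‖ ^ 2) (fun s _ => by positivity)
      (Finset.mem_univ i)).trans (sum_norm_col_sq_le A j)
  exact (pow_le_pow_iff_left₀ (norm_nonneg _) (norm_nonneg _) two_ne_zero).1 h1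

theorem sum_norm_row_sq_le (A : Matrix V V ℂ) (j : V) :
    ∑ s, ‖A j s‖ ^ 2 ≤ ‖A‖ ^ 2 := by
  have h := sum_norm_col_sq_le A.conjTranspose j
  rw [Matrix.l2_opNorm_conjTranspose] at h
  simpa [Matrix.conjTranspose_apply] using h

/-- Column `k` of `A D A` is `A` applied to the vector `D s * A s k`; then `D ^ 2 ≤ D` and the rows
of `A` have length at most one. The bound is `∑ D s` and not the dimension, which is what makes it
useful for local averages. -/
theorem sum_norm_sq_mul_diagonal_mul_le {A : Matrix V V ℂ} (hA : ‖A‖ ≤ 1) {D : V → ℝ}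
    (hD0 : ∀ s, 0 ≤ D s) (hD1 : ∀ s, D s ≤ 1) :
    ∑ j, ∑ k, ‖(A * Matrix.diagonal (fun s => (D s : ℂ)) * A) j k‖ ^ 2 ≤ ∑ s, D s := by
  have hA2 : ‖A‖ ^ 2 ≤ 1 := pow_le_one₀ (norm_nonneg _) hA
  rw [Finset.sum_comm]
  calc ∑ k, ∑ j, ‖(A * Matrix.diagonal (fun s => (D s : ℂ)) * A) j k‖ ^ 2
      ≤ ∑ k, ∑ s, D s * ‖A s k‖ ^ 2 := by
        refine Finset.sum_le_sum fun k _ => ?_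
        have h := sum_norm_mulVec_sq_le A (fun s => (D s : ℂ) * A s k)
        have h2 : ∀ j, (A.mulVec (fun s => (D s : ℂ) * A s k)) j =
            (A * Matrix.diagonal (fun s => (D s : ℂ)) * A) j k := by
          intro j
          rw [Matrix.mul_apply]
          simp [Matrix.mulVec, dotProduct, Matrix.mul_diagonal, mul_assoc]
        simp_rw [h2] at h
        refine h.trans ?_
        refine (mul_le_of_le_one_left (Finset.sum_nonneg fun _ _ => by positivity) hA2).trans ?_
        refine Finset.sum_le_sum fun s _ => ?_
        rw [norm_mul, mul_pow, Complex.norm_real, Real.norm_of_nonneg (hD0 s)]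
        have : D s ^ 2 ≤ D s := by nlinarith [hD0 s, hD1 s]
        gcongr
    _ = ∑ s, D s * ∑ k, ‖A s k‖ ^ 2 := by
        rw [Finset.sum_comm]; simp [Finset.mul_sum]
    _ ≤ ∑ s, D s := by
        refine Finset.sum_le_sum fun s _ => ?_
        exact mul_le_of_le_one_right (hD0 s) ((sum_norm_row_sq_le A s).trans hA2)

theorem norm_single_le (i j : V) : ‖(Matrix.single i j 1 : Matrix V V ℂ)‖ ≤ 1 := by
  rw [← Matrix.l2_opNorm_toEuclideanCLM]
  refine ContinuousLinearMap.opNorm_le_bound _ zero_le_one fun x => ?_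
  refine (pow_le_pow_iff_left₀ (norm_nonneg _) (by positivity) two_ne_zero).1 ?_
  rw [one_mul, EuclideanSpace.norm_sq_eq, EuclideanSpace.norm_sq_eq]
  simp only [Matrix.ofLp_toEuclideanCLM, Matrix.single_mulVec]
  rw [Finset.sum_eq_single i]
  · simpa using Finset.single_le_sum (f := fun s => ‖x s‖ ^ 2) (fun s _ => by positivity)
      (Finset.mem_univ j)
  · intro s _ hs; simp [Function.update, hs]
  · simp

/-- The quadratic form of a Hermitian matrix is real, so the imaginary part of `⟨y, (A - z) y⟩` is
`-Im z * ‖y‖ ^ 2`; Cauchy–Schwarz finishes. Invertibility of `A - z` and the resolvent bound both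
follow. -/
theorem norm_mul_le_norm_sub_smul_mulVec {A : Matrix V V ℂ} (hA : A.IsHermitian) (z : ℂ)
    (y : EuclideanSpace ℂ V) :
    |z.im| * ‖y‖ ≤ ‖Matrix.toEuclideanCLM (n := V) (𝕜 := ℂ) (A - z • 1) y‖ := by
  have hsym : (inner ℂ y (Matrix.toEuclideanCLM (n := V) (𝕜 := ℂ) A y)).im = 0 := by
    have hs := (Matrix.isSymmetric_toEuclideanLin_iff.2 hA)
    have := hs.im_inner_self_apply y
    rw [← Matrix.coe_toEuclideanCLM_eq_toEuclideanLin] at this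
    have h2 := inner_im_symm (𝕜 := ℂ) y (Matrix.toEuclideanCLM (n := V) (𝕜 := ℂ) A y)
    simp only [RCLike.im_to_complex] at this h2
    simp_all
  have h1 : (inner ℂ y (Matrix.toEuclideanCLM (n := V) (𝕜 := ℂ) (A - z • 1) y)).im =
      - z.im * ‖y‖ ^ 2 := by
    rw [map_sub, map_smul, map_one]
    simp only [sub_apply, smul_apply,
      one_apply_eq_self, inner_sub_right, inner_smul_right, Complex.sub_im, hsym,
      inner_self_eq_norm_sq_to_K]
    have : ((‖y‖ : ℂ) ^ 2) = ((‖y‖ ^ 2 : ℝ) : ℂ) := by push_cast; rfl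
    simp only [Complex.coe_algebraMap, this, Complex.im_mul_ofReal]
    ring
  have h2 : |z.im| * ‖y‖ ^ 2 ≤
      ‖y‖ * ‖Matrix.toEuclideanCLM (n := V) (𝕜 := ℂ) (A - z • 1) y‖ := by
    calc |z.im| * ‖y‖ ^ 2 = |(inner ℂ y
          (Matrix.toEuclideanCLM (n := V) (𝕜 := ℂ) (A - z • 1) y)).im| := by
          rw [h1, abs_mul, abs_neg, abs_of_nonneg (sq_nonneg ‖y‖)]
      _ ≤ _ := (Complex.abs_im_le_norm _).trans (norm_inner_le_norm _ _)
  rcases eq_or_lt_of_le (norm_nonneg y) with h | h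
  · rw [← h, mul_zero]; exact norm_nonneg _
  · nlinarith

theorem isUnit_sub_smul {A : Matrix V V ℂ} (hA : A.IsHermitian) {z : ℂ} (hz : 0 < |z.im|) :
    IsUnit (A - z • (1 : Matrix V V ℂ)) := by
  rw [← Matrix.mulVec_injective_iff_isUnit]
  intro u w huw
  have h := norm_mul_le_norm_sub_smul_mulVec hA z (WithLp.toLp 2 (u - w))
  rw [Matrix.toEuclideanCLM_toLp, Matrix.mulVec_sub, sub_eq_zero.2 huw] at h
  simp only [WithLp.toLp_zero, norm_zero] at h
  have h3 : ‖WithLp.toLp 2 (u - w)‖ ≤ 0 := by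
    by_contra hc
    push Not at hc
    have := mul_pos hz hc
    linarith
  have h4 : WithLp.toLp 2 (u - w) = 0 := norm_le_zero_iff.1 h3
  have h5 : u - w = 0 := congrArg WithLp.ofLp h4
  exact sub_eq_zero.1 h5

theorem norm_inv_sub_smul_le {A : Matrix V V ℂ} (hA : A.IsHermitian) {z : ℂ} (hz : 0 < |z.im|) :
    ‖(A - z • (1 : Matrix V V ℂ))⁻¹‖ ≤ |z.im|⁻¹ := by
  rw [← Matrix.l2_opNorm_toEuclideanCLM]
  refine ContinuousLinearMap.opNorm_le_bound _ (by positivity) fun x => ?_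
  have h := norm_mul_le_norm_sub_smul_mulVec hA z
    (Matrix.toEuclideanCLM (n := V) (𝕜 := ℂ) (A - z • (1 : Matrix V V ℂ))⁻¹ x)
  rw [← mul_apply_eq_comp, ← map_mul, Matrix.mul_nonsing_inv _
    ((Matrix.isUnit_iff_isUnit_det _).1 (isUnit_sub_smul hA hz)), map_one,
    one_apply_eq_self] at h
  rw [inv_mul_eq_div, le_div_iff₀ hz, mul_comm]
  exact h

end MatrixNorm

/-! ### The resolvent as a function of the edge variables, and its perturbation in one entry -/

section Resolvent

variable {n : ℕ}

/-- The symmetric matrix with given entries on and above the diagonal. -/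
noncomputable def symMatrix (x : Edge n → ℝ) : Matrix (Site n) (Site n) ℂ :=
  Matrix.of fun i j => (x (edge i j) : ℂ)

/-- The resolvent as a function of the matrix entries. -/
noncomputable def green (z : ℂ) (x : Edge n → ℝ) : Matrix (Site n) (Site n) ℂ :=
  (symMatrix x - z • (1 : Matrix (Site n) (Site n) ℂ))⁻¹

/-- The ordered pairs of sites whose underlying edge is `e`. -/
noncomputable def pairs (e : Edge n) : Finset (Site n × Site n) :=
  Finset.univ.filter fun p => edge p.1 p.2 = e

/-- The derivative of `symMatrix` in the direction of the coordinate `e`. -/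
noncomputable def bump (e : Edge n) : Matrix (Site n) (Site n) ℂ :=
  Matrix.of fun i j => if edge i j = e then 1 else 0

/-- The configuration with the value at `e` replaced by `0`. -/
noncomputable def erase (e : Edge n) (x : Edge n → ℝ) : Edge n → ℝ := Function.update x e 0

theorem edge_comm (i j : Site n) : edge i j = edge j i := by
  simp [edge, min_comm, max_comm]

theorem mem_pairs {e : Edge n} {p : Site n × Site n} : p ∈ pairs e ↔ edge p.1 p.2 = e := by
  simp [pairs]

theorem swap_mem_pairs {e : Edge n} {p : Site n × Site n} : p.swap ∈ pairs e ↔ p ∈ pairs e := by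
  simp [mem_pairs, edge_comm p.1]

theorem pairs_subset (e : Edge n) : pairs e ⊆ {(e.1.1, e.1.2), (e.1.2, e.1.1)} := by
  rintro ⟨i, j⟩ h
  rw [mem_pairs] at h
  subst h
  simp only [edge, Finset.mem_insert, Finset.mem_singleton, Prod.mk.injEq]
  rcases le_total i j with h | h <;> simp [h]

theorem card_pairs_le (e : Edge n) : (pairs e).card ≤ 2 :=
  (Finset.card_le_card (pairs_subset e)).trans Finset.card_le_two

/-- Every ordered pair of sites lies over exactly one edge, so sums over edges and their
orientations are full double sums over sites. -/
theorem sum_pairs (f : Edge n → Site n × Site n → ℝ) :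
    ∑ e, ∑ p ∈ pairs e, f e p = ∑ i, ∑ j, f (edge i j) (i, j) := by
  rw [← Finset.sum_product', Finset.univ_product_univ,
    ← Finset.sum_fiberwise Finset.univ (fun p : Site n × Site n => edge p.1 p.2)]
  refine Finset.sum_congr rfl fun e _ => Finset.sum_congr rfl fun p hp => ?_
  rw [mem_pairs.1 hp]

/-- The sum has two terms off the diagonal and one on it, so both kinds of edge are treated by the
same formulas. -/
theorem bump_eq_sum (e : Edge n) : bump e = ∑ p ∈ pairs e, Matrix.single p.1 p.2 1 := by
  ext i j
  rw [Matrix.sum_apply]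
  simp only [bump, Matrix.of_apply, Matrix.single_apply]
  by_cases h : edge i j = e
  · rw [if_pos h, Finset.sum_eq_single (i, j)]
    · simp
    · rintro ⟨a, b⟩ _ hne
      rw [if_neg]
      rintro ⟨rfl, rfl⟩
      exact hne rfl
    · intro h'; exact absurd (mem_pairs.2 h) h'
  · rw [if_neg h, Finset.sum_eq_zero]
    rintro ⟨a, b⟩ hp
    rw [if_neg]
    rintro ⟨rfl, rfl⟩
    exact h (mem_pairs.1 hp)

theorem norm_bump_le (e : Edge n) : ‖bump e‖ ≤ 2 := by
  rw [bump_eq_sum]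
  refine (norm_sum_le_of_le _ fun p _ => norm_single_le p.1 p.2).trans ?_
  simpa using (by exact_mod_cast card_pairs_le e : ((pairs e).card : ℝ) ≤ 2)

theorem mul_bump_mul_apply (A B : Matrix (Site n) (Site n) ℂ) (e : Edge n) (i j : Site n) :
    (A * bump e * B) i j = ∑ p ∈ pairs e, A i p.1 * B p.2 j := by
  rw [bump_eq_sum, Matrix.mul_sum, Matrix.sum_mul, Matrix.sum_apply]
  refine Finset.sum_congr rfl fun p _ => ?_
  rw [Matrix.mul_assoc, Matrix.mul_apply]
  rw [Finset.sum_eq_single p.1]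
  · simp
  · intro s _ hs
    rw [Matrix.single_mul_apply_of_ne _ _ _ _ _ hs, mul_zero]
  · simp

theorem trace_bump_mul (A : Matrix (Site n) (Site n) ℂ) (e : Edge n) :
    (bump e * A).trace = ∑ p ∈ pairs e, A p.2 p.1 := by
  rw [bump_eq_sum, Matrix.sum_mul, Matrix.trace_sum]
  refine Finset.sum_congr rfl fun p _ => ?_
  rw [Matrix.trace_single_mul]
  simp

theorem symMatrix_isHermitian (x : Edge n → ℝ) : (symMatrix x).IsHermitian := by
  ext i j
  simp [symMatrix, edge_comm i j]

theorem symMatrix_eq_erase_add (x : Edge n → ℝ) (e : Edge n) :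
    symMatrix x = symMatrix (erase e x) + (x e : ℂ) • bump e := by
  ext i j
  simp only [symMatrix, erase, bump, Matrix.of_apply, Matrix.add_apply, Matrix.smul_apply]
  by_cases h : edge i j = e
  · simp [h]
  · simp [h]

variable {z : ℂ}

theorem isUnit_det (hz : 0 < |z.im|) (x : Edge n → ℝ) :
    IsUnit (symMatrix x - z • (1 : Matrix (Site n) (Site n) ℂ)).det :=
  (Matrix.isUnit_iff_isUnit_det _).1 (isUnit_sub_smul (symMatrix_isHermitian x) hz)

theorem norm_green_le (hz : 0 < |z.im|) (x : Edge n → ℝ) : ‖green z x‖ ≤ |z.im|⁻¹ :=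
  norm_inv_sub_smul_le (symMatrix_isHermitian x) hz

theorem norm_green_le_one (hz : 1 ≤ |z.im|) (x : Edge n → ℝ) : ‖green z x‖ ≤ 1 :=
  (norm_green_le (by linarith) x).trans (inv_le_one_of_one_le₀ hz)

theorem green_symm (x : Edge n → ℝ) (i j : Site n) : green z x i j = green z x j i := by
  have h : (green z x).transpose = green z x := by
    rw [green, Matrix.transpose_nonsing_inv]
    congr 1
    ext i j
    simp [symMatrix, edge_comm i j, Matrix.one_apply, eq_comm]
  rw [← h, Matrix.transpose_apply, h]

/-- The resolvent identity, with the unperturbed resolvent on the left. -/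
theorem green_sub (hz : 0 < |z.im|) (x : Edge n → ℝ) (e : Edge n) :
    green z x = green z (erase e x) -
      (x e : ℂ) • (green z (erase e x) * bump e * green z x) := by
  set A := symMatrix x - z • (1 : Matrix (Site n) (Site n) ℂ) with hA
  set B := symMatrix (erase e x) - z • (1 : Matrix (Site n) (Site n) ℂ) with hB
  have hAB : (x e : ℂ) • bump e = A - B := by
    rw [hA, hB, symMatrix_eq_erase_add x e]; abel
  have h1 : A * A⁻¹ = 1 := Matrix.mul_nonsing_inv _ (isUnit_det hz x)
  have h2 : B⁻¹ * B = 1 := Matrix.nonsing_inv_mul _ (isUnit_det hz (erase e x))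
  change A⁻¹ = B⁻¹ - (x e : ℂ) • (B⁻¹ * bump e * A⁻¹)
  rw [← smul_mul_assoc, ← mul_smul_comm, hAB, mul_sub, h2, sub_mul, mul_assoc, h1]
  simp

/-- The resolvent identity, with the unperturbed resolvent on the right. -/
theorem green_sub' (hz : 0 < |z.im|) (x : Edge n → ℝ) (e : Edge n) :
    green z x = green z (erase e x) -
      (x e : ℂ) • (green z x * bump e * green z (erase e x)) := by
  set A := symMatrix x - z • (1 : Matrix (Site n) (Site n) ℂ) with hA
  set B := symMatrix (erase e x) - z • (1 : Matrix (Site n) (Site n) ℂ) with hB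
  have hAB : (x e : ℂ) • bump e = A - B := by
    rw [hA, hB, symMatrix_eq_erase_add x e]; abel
  have h1 : A⁻¹ * A = 1 := Matrix.nonsing_inv_mul _ (isUnit_det hz x)
  have h2 : B * B⁻¹ = 1 := Matrix.mul_nonsing_inv _ (isUnit_det hz (erase e x))
  change A⁻¹ = B⁻¹ - (x e : ℂ) • (A⁻¹ * bump e * B⁻¹)
  rw [← smul_mul_assoc, ← mul_smul_comm, hAB, mul_sub, h1, sub_mul, mul_assoc, h2]
  simp

theorem continuous_symMatrix : Continuous (symMatrix (n := n)) := by
  refine continuous_matrix fun i j => ?_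
  exact Complex.continuous_ofReal.comp (continuous_apply _)

theorem continuous_green (hz : 0 < |z.im|) : Continuous (green (n := n) z) := by
  have hc : Continuous fun x : Edge n → ℝ =>
      symMatrix x - z • (1 : Matrix (Site n) (Site n) ℂ) :=
    continuous_symMatrix.sub continuous_const
  have h : green (n := n) z = fun x =>
      (symMatrix x - z • (1 : Matrix (Site n) (Site n) ℂ)).det⁻¹ •
        (symMatrix x - z • (1 : Matrix (Site n) (Site n) ℂ)).adjugate := by
    ext1 x
    rw [green, Matrix.inv_def, Ring.inverse_eq_inv']
  rw [h]
  exact (hc.matrix_det.inv₀ fun x => (isUnit_det hz x).ne_zero).smul hc.matrix_adjugate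

theorem continuous_erase (e : Edge n) : Continuous (erase e) :=
  continuous_id.update e continuous_const

@[simp] theorem erase_erase (e : Edge n) (x : Edge n → ℝ) : erase e (erase e x) = erase e x := by
  simp [erase]

end Resolvent

/-! ### Deterministic estimates for the change of a weighted trace when one entry is erased -/

section Deterministic

variable {n : ℕ} {D : Site n → ℝ}

/-- The weighted squared length of the columns of `A` that meet the edge `e`. -/
noncomputable def columnMass (D : Site n → ℝ) (e : Edge n) (A : Matrix (Site n) (Site n) ℂ) : ℝ :=
  ∑ p ∈ pairs e, ∑ s, D s * ‖A s p.1‖ ^ 2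

theorem columnMass_nonneg (hD0 : ∀ s, 0 ≤ D s) (e : Edge n) (A : Matrix (Site n) (Site n) ℂ) :
    0 ≤ columnMass D e A :=
  Finset.sum_nonneg fun _ _ => Finset.sum_nonneg fun s _ => mul_nonneg (hD0 s) (by positivity)

theorem columnMass_le_two (hD1 : ∀ s, D s ≤ 1) (e : Edge n)
    {A : Matrix (Site n) (Site n) ℂ} (hA : ‖A‖ ≤ 1) : columnMass D e A ≤ 2 := by
  have h1 : ∀ p ∈ pairs e, ∑ s, D s * ‖A s p.1‖ ^ 2 ≤ 1 := fun p _ =>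
    (Finset.sum_le_sum fun s _ => mul_le_of_le_one_left (by positivity) (hD1 s)).trans
      ((sum_norm_col_sq_le A p.1).trans (pow_le_one₀ (norm_nonneg _) hA))
  refine (Finset.sum_le_sum h1).trans ?_
  simpa using (by exact_mod_cast card_pairs_le e : ((pairs e).card : ℝ) ≤ 2)

theorem sum_sq_le_two_mul (e : Edge n) (f : Site n × Site n → ℝ) :
    (∑ p ∈ pairs e, f p) ^ 2 ≤ 2 * ∑ p ∈ pairs e, f p ^ 2 := by
  refine (sq_sum_le_card_mul_sum_sq).trans ?_
  have : ((pairs e).card : ℝ) ≤ 2 := by exact_mod_cast card_pairs_le e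
  have h0 : 0 ≤ ∑ p ∈ pairs e, f p ^ 2 := Finset.sum_nonneg fun _ _ => sq_nonneg _
  gcongr

/-- In `B * bump e * A` the only columns of `B` that enter are those meeting `e`, multiplied by
entries of `A` of size at most one. Hence the masses of these columns with and without the entry
control each other. The `8` is `2 * 2 * 2`: the square of a sum of two, the square of a sum over
`pairs e`, and the number of columns. -/
theorem columnMass_le_of_eq_sub (hD0 : ∀ s, 0 ≤ D s) (e : Edge n)
    {A B : Matrix (Site n) (Site n) ℂ} (hA : ‖A‖ ≤ 1) (h : ℝ)
    (hAB : A = B - (h : ℂ) • (B * bump e * A)) :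
    columnMass D e A ≤ (2 + 8 * h ^ 2) * columnMass D e B := by
  have h1 : ∀ s j, ‖A s j‖ ^ 2 ≤
      2 * ‖B s j‖ ^ 2 + 4 * h ^ 2 * ∑ q ∈ pairs e, ‖B s q.1‖ ^ 2 := by
    intro s j
    have h2 : A s j = B s j - (h : ℂ) * ∑ q ∈ pairs e, B s q.1 * A q.2 j := by
      conv_lhs => rw [hAB]
      rw [Matrix.sub_apply, Matrix.smul_apply, mul_bump_mul_apply, smul_eq_mul]
    have h3 : ‖A s j‖ ≤ ‖B s j‖ + |h| * ∑ q ∈ pairs e, ‖B s q.1‖ := by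
      rw [h2]
      refine (norm_sub_le _ _).trans ?_
      rw [norm_mul, Complex.norm_real, Real.norm_eq_abs]
      gcongr
      refine norm_sum_le_of_le _ fun q _ => ?_
      rw [norm_mul]
      exact mul_le_of_le_one_right (norm_nonneg _) ((norm_entry_le A _ _).trans hA)
    have h4 := pow_le_pow_left₀ (norm_nonneg _) h3 2
    have h5 := sum_sq_le_two_mul e (fun q => ‖B s q.1‖)
    have h6 := sq_nonneg (‖B s j‖ - |h| * ∑ q ∈ pairs e, ‖B s q.1‖)
    have h7 := mul_le_mul_of_nonneg_left h5 (sq_nonneg |h|)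
    rw [← sq_abs h]
    nlinarith
  have h8 : ∀ p ∈ pairs e, ∑ s, D s * ‖A s p.1‖ ^ 2 ≤
      2 * ∑ s, D s * ‖B s p.1‖ ^ 2 + 4 * h ^ 2 * columnMass D e B := by
    intro p _
    rw [columnMass, Finset.sum_comm, Finset.mul_sum, Finset.mul_sum, ← Finset.sum_add_distrib]
    refine Finset.sum_le_sum fun s _ => ?_
    rw [← Finset.mul_sum]
    have := mul_le_mul_of_nonneg_left (h1 s p.1) (hD0 s)
    linarith
  have h9 := Finset.sum_le_sum h8
  rw [Finset.sum_add_distrib, ← Finset.mul_sum, Finset.sum_const, nsmul_eq_mul] at h9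
  have h10 : ((pairs e).card : ℝ) ≤ 2 := by exact_mod_cast card_pairs_le e
  have h11 := mul_le_mul_of_nonneg_right h10
    (mul_nonneg (by positivity : 0 ≤ 4 * h ^ 2) (columnMass_nonneg hD0 e B))
  change columnMass D e A ≤ 2 * columnMass D e B + _ at h9
  linarith

/-- The arithmetic–geometric mean inequality inside the matrix product. Symmetry of `A` turns row
`p.2` into a column, which meets `e` because `p.swap` also lies over `e`. -/
theorem norm_mul_diagonal_mul_apply_le (hD0 : ∀ s, 0 ≤ D s) {e : Edge n}
    {A B : Matrix (Site n) (Site n) ℂ} (hA : ∀ i j, A i j = A j i) {p q : Site n × Site n}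
    (hp : p ∈ pairs e) (hq : q ∈ pairs e) :
    ‖(A * Matrix.diagonal (fun s => (D s : ℂ)) * B) p.2 q.1‖ ≤
      (columnMass D e A + columnMass D e B) / 2 := by
  have hmass : ∀ (C : Matrix (Site n) (Site n) ℂ) {r} (_ : r ∈ pairs e),
      ∑ s, D s * ‖C s r.1‖ ^ 2 ≤ columnMass D e C := fun C r hr =>
    Finset.single_le_sum (f := fun r : Site n × Site n => ∑ s, D s * ‖C s r.1‖ ^ 2)
      (fun _ _ => Finset.sum_nonneg fun s _ => mul_nonneg (hD0 s) (by positivity)) hr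
  have h1 := hmass A (swap_mem_pairs.2 hp)
  have h2 := hmass B hq
  rw [Matrix.mul_apply]
  have h3 : ∀ s, ‖(A * Matrix.diagonal (fun s => (D s : ℂ))) p.2 s * B s q.1‖ ≤
      (D s * ‖A s p.2‖ ^ 2 + D s * ‖B s q.1‖ ^ 2) / 2 := by
    intro s
    rw [Matrix.mul_diagonal, norm_mul, norm_mul, Complex.norm_real, Real.norm_of_nonneg (hD0 s),
      hA p.2 s]
    have := mul_nonneg (hD0 s) (sq_nonneg (‖A s p.2‖ - ‖B s q.1‖))
    nlinarith
  refine (norm_sum_le_of_le _ fun s _ => h3 s).trans ?_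
  rw [← Finset.sum_div, Finset.sum_add_distrib]
  simp only [Prod.fst_swap] at h1
  linarith

theorem sum_pairs_le_four_mul {e : Edge n} {f : Site n × Site n → Site n × Site n → ℂ} {m : ℝ}
    (hm : 0 ≤ m) (hf : ∀ p ∈ pairs e, ∀ q ∈ pairs e, ‖f p q‖ ≤ m) :
    ‖∑ p ∈ pairs e, ∑ q ∈ pairs e, f p q‖ ≤ 4 * m := by
  have h10 : ((pairs e).card : ℝ) ≤ 2 := by exact_mod_cast card_pairs_le e
  refine (norm_sum_le_of_le _ fun p hp => norm_sum_le_of_le _ fun q hq => hf p hp q hq).trans ?_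
  simp only [Finset.sum_const, nsmul_eq_mul]
  have h11 : ((pairs e).card : ℝ) * m ≤ 2 * m := by gcongr
  have h12 : ((pairs e).card : ℝ) * (((pairs e).card : ℝ) * m) ≤ 2 * (2 * m) := by gcongr
  linarith

/-- The sum of `D s * G s s` over all sites. -/
noncomputable def weightedTrace (z : ℂ) (D : Site n → ℝ) (x : Edge n → ℝ) : ℂ :=
  ∑ s, (D s : ℂ) * green z x s s

/-- Minus the derivative of `weightedTrace` in the direction of the coordinate `e`. -/
noncomputable def traceSlope (z : ℂ) (D : Site n → ℝ) (e : Edge n) (x : Edge n → ℝ) : ℂ :=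
  ∑ p ∈ pairs e, (green z x * Matrix.diagonal (fun s => (D s : ℂ)) * green z x) p.2 p.1

variable {z : ℂ}

theorem weightedTrace_eq_trace (x : Edge n → ℝ) :
    weightedTrace z D x = (Matrix.diagonal (fun s => (D s : ℂ)) * green z x).trace := by
  simp [weightedTrace, Matrix.trace, Matrix.diagonal_mul]

/-- The resolvent identity is used twice, the second time on the `G` left over from the first. The
quadratic remainder is therefore exact and no power series is needed. -/
theorem trace_mul_sub_trace_mul (Δ : Matrix (Site n) (Site n) ℂ) (e : Edge n)
    {G P : Matrix (Site n) (Site n) ℂ} {h : ℂ} (hG : G = P - h • (P * bump e * G)) :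
    (Δ * G).trace - (Δ * P).trace + h * ∑ p ∈ pairs e, (P * Δ * P) p.2 p.1 =
      h ^ 2 * ∑ p ∈ pairs e, ∑ q ∈ pairs e, P p.2 q.1 * (G * Δ * P) q.2 p.1 := by
  have e2 : G * Δ * P = P * Δ * P - h • (P * bump e * (G * Δ * P)) := by
    conv_lhs => rw [hG]
    simp only [sub_mul, smul_mul_assoc, mul_assoc]
  have e3 : (Δ * G).trace - (Δ * P).trace = -h * ∑ p ∈ pairs e, (G * Δ * P) p.2 p.1 := by
    rw [← trace_bump_mul, ← Matrix.trace_sub, ← mul_sub]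
    have : G - P = -(h • (P * bump e * G)) := by
      conv_lhs => rw [hG]
      abel
    rw [this, mul_neg, mul_smul_comm, Matrix.trace_neg, Matrix.trace_smul, smul_eq_mul, neg_mul]
    congr 2
    rw [Matrix.trace_mul_comm, mul_assoc P, mul_assoc, Matrix.trace_mul_comm]
    simp only [mul_assoc]
  have e4 : ∀ p : Site n × Site n, (G * Δ * P) p.2 p.1 = (P * Δ * P) p.2 p.1 -
      h * ∑ q ∈ pairs e, P p.2 q.1 * (G * Δ * P) q.2 p.1 := by
    intro p
    conv_lhs => rw [e2]
    rw [Matrix.sub_apply, Matrix.smul_apply, mul_bump_mul_apply, smul_eq_mul]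
  rw [e3, Finset.sum_congr rfl fun p _ => e4 p, Finset.sum_sub_distrib, ← Finset.mul_sum]
  ring

theorem sum_mul_mul_sub (Δ : Matrix (Site n) (Site n) ℂ) (e : Edge n)
    {G P : Matrix (Site n) (Site n) ℂ} {h : ℂ} (hG : G = P - h • (P * bump e * G))
    (hG' : G = P - h • (G * bump e * P)) :
    ∑ p ∈ pairs e, (G * Δ * G) p.2 p.1 - ∑ p ∈ pairs e, (P * Δ * P) p.2 p.1 =
      -(h * ((∑ p ∈ pairs e, ∑ q ∈ pairs e, P p.2 q.1 * (G * Δ * G) q.2 p.1) +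
        ∑ p ∈ pairs e, ∑ q ∈ pairs e, (P * Δ * G) p.2 q.1 * P q.2 p.1)) := by
  have hsub : G - P = -(h • (P * bump e * G)) := by
    conv_lhs => rw [hG]
    abel
  have hsub' : G - P = -(h • (G * bump e * P)) := by
    conv_lhs => rw [hG']
    abel
  have e1 : G * Δ * G - P * Δ * P =
      -(h • (P * bump e * (G * Δ * G))) - h • ((P * Δ * G) * bump e * P) := by
    have e3 : (G - P) * (Δ * G) = -(h • (P * bump e * (G * Δ * G))) := by
      rw [hsub, neg_mul, smul_mul_assoc]
      simp only [mul_assoc]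
    have e4 : P * Δ * (G - P) = -(h • ((P * Δ * G) * bump e * P)) := by
      rw [hsub', mul_neg, mul_smul_comm]
      simp only [mul_assoc]
    calc G * Δ * G - P * Δ * P = (G - P) * (Δ * G) + P * Δ * (G - P) := by noncomm_ring
      _ = _ := by rw [e3, e4, sub_eq_add_neg]
  have e5 : ∀ p : Site n × Site n, (G * Δ * G) p.2 p.1 - (P * Δ * P) p.2 p.1 =
      -(h * ∑ q ∈ pairs e, P p.2 q.1 * (G * Δ * G) q.2 p.1) -
        h * ∑ q ∈ pairs e, (P * Δ * G) p.2 q.1 * P q.2 p.1 := by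
    intro p
    rw [← Matrix.sub_apply, e1, Matrix.sub_apply, Matrix.neg_apply, Matrix.smul_apply,
      Matrix.smul_apply, mul_bump_mul_apply, mul_bump_mul_apply, smul_eq_mul, smul_eq_mul]
  rw [← Finset.sum_sub_distrib, Finset.sum_congr rfl fun p _ => e5 p, Finset.sum_sub_distrib,
    Finset.sum_neg_distrib, ← Finset.mul_sum, ← Finset.mul_sum]
  ring

theorem norm_sum_pairs_mul_le (hD0 : ∀ s, 0 ≤ D s) (e : Edge n)
    {A B C : Matrix (Site n) (Site n) ℂ} (hA : ‖A‖ ≤ 1) (hB : ∀ i j, B i j = B j i) :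
    ‖∑ p ∈ pairs e, ∑ q ∈ pairs e,
      A p.2 q.1 * (B * Matrix.diagonal (fun s => (D s : ℂ)) * C) q.2 p.1‖ ≤
      2 * (columnMass D e B + columnMass D e C) := by
  have hm : 0 ≤ (columnMass D e B + columnMass D e C) / 2 := by
    have := columnMass_nonneg hD0 e B
    have := columnMass_nonneg hD0 e C
    positivity
  have h1 : ∀ p ∈ pairs e, ∀ q ∈ pairs e,
      ‖A p.2 q.1 * (B * Matrix.diagonal (fun s => (D s : ℂ)) * C) q.2 p.1‖ ≤
        (columnMass D e B + columnMass D e C) / 2 := by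
    intro p hp q hq
    have h2 : ‖A p.2 q.1‖ ≤ 1 := (norm_entry_le A p.2 q.1).trans hA
    have h3 := norm_mul_diagonal_mul_apply_le (B := C) hD0 hB hq hp
    rw [norm_mul]
    exact (mul_le_of_le_one_left (norm_nonneg _) h2).trans h3
  have h4 := sum_pairs_le_four_mul (e := e) (f := fun p q => A p.2 q.1 *
    (B * Matrix.diagonal (fun s => (D s : ℂ)) * C) q.2 p.1) hm h1
  refine h4.trans (le_of_eq ?_)
  ring

theorem norm_sum_pairs_mul_le' (hD0 : ∀ s, 0 ≤ D s) (e : Edge n)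
    {A B C : Matrix (Site n) (Site n) ℂ} (hA : ‖A‖ ≤ 1) (hB : ∀ i j, B i j = B j i) :
    ‖∑ p ∈ pairs e, ∑ q ∈ pairs e,
      (B * Matrix.diagonal (fun s => (D s : ℂ)) * C) p.2 q.1 * A q.2 p.1‖ ≤
      2 * (columnMass D e B + columnMass D e C) := by
  rw [Finset.sum_comm]
  have h := norm_sum_pairs_mul_le (A := A) (C := C) hD0 e hA hB
  simp only [mul_comm (A _ _)] at h
  exact h

theorem norm_weightedTrace_sub_le (hz : 1 ≤ |z.im|) (hD0 : ∀ s, 0 ≤ D s) (e : Edge n)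
    (x : Edge n → ℝ) :
    ‖weightedTrace z D x - weightedTrace z D (erase e x) +
        (x e : ℂ) * traceSlope z D e (erase e x)‖ ≤
      2 * x e ^ 2 * (columnMass D e (green z x) + columnMass D e (green z (erase e x))) := by
  rw [weightedTrace_eq_trace, weightedTrace_eq_trace, traceSlope,
    trace_mul_sub_trace_mul _ e (green_sub (by linarith) x e), norm_mul, norm_pow,
    Complex.norm_real, Real.norm_eq_abs, sq_abs]
  have h1 := norm_sum_pairs_mul_le (C := green z (erase e x)) hD0 e
    (norm_green_le_one hz (erase e x)) (green_symm (z := z) x)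
  refine (mul_le_mul_of_nonneg_left h1 (sq_nonneg (x e))).trans (le_of_eq ?_)
  ring

theorem norm_traceSlope_sub_le (hz : 1 ≤ |z.im|) (hD0 : ∀ s, 0 ≤ D s) (e : Edge n)
    (x : Edge n → ℝ) :
    ‖traceSlope z D e x - traceSlope z D e (erase e x)‖ ≤
      6 * |x e| * (columnMass D e (green z x) + columnMass D e (green z (erase e x))) := by
  have hz0 : 0 < |z.im| := by linarith
  rw [traceSlope, traceSlope, sum_mul_mul_sub _ e (green_sub hz0 x e) (green_sub' hz0 x e),
    norm_neg, norm_mul, Complex.norm_real, Real.norm_eq_abs]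
  have h0 := columnMass_nonneg hD0 e (green z (erase e x))
  have h1 := norm_sum_pairs_mul_le (C := green z x) hD0 e (norm_green_le_one hz (erase e x))
    (green_symm (z := z) x)
  have h2 := norm_sum_pairs_mul_le' (C := green z x) hD0 e (norm_green_le_one hz (erase e x))
    (green_symm (z := z) (erase e x))
  have h3 := mul_le_mul_of_nonneg_left ((norm_add_le _ _).trans (add_le_add h1 h2))
    (abs_nonneg (x e))
  have h4 := mul_nonneg (abs_nonneg (x e)) h0
  refine h3.trans ?_
  linarith

theorem columnMass_green_le (hz : 1 ≤ |z.im|) (hD0 : ∀ s, 0 ≤ D s) (e : Edge n)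
    (x : Edge n → ℝ) :
    columnMass D e (green z x) ≤ (2 + 8 * x e ^ 2) * columnMass D e (green z (erase e x)) :=
  columnMass_le_of_eq_sub hD0 e (norm_green_le_one hz x) (x e) (green_sub (by linarith) x e)

theorem columnMass_green_erase_le (hz : 1 ≤ |z.im|) (hD0 : ∀ s, 0 ≤ D s) (e : Edge n)
    (x : Edge n → ℝ) :
    columnMass D e (green z (erase e x)) ≤ (2 + 8 * x e ^ 2) * columnMass D e (green z x) := by
  have h := columnMass_le_of_eq_sub hD0 e (norm_green_le_one hz (erase e x)) (-x e)
    (B := green z x) (by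
      have h := green_sub' (z := z) (by linarith) x e
      push_cast
      rw [neg_smul, sub_neg_eq_add, ← sub_eq_iff_eq_add]
      exact h.symm)
  simpa using h

/-- The slope and the mass are taken at the erased configuration so that they are independent of `x
e`. As each mass is at most `2`, the squared remainder is bounded linearly in the mass: `8 x⁴ (S +
S') ^ 2 ≤ 32 x⁴ (3 + 8 x²) S'`, whence `96` and `256`. -/
theorem norm_weightedTrace_sub_sq_le (hz : 1 ≤ |z.im|) (hD0 : ∀ s, 0 ≤ D s)
    (hD1 : ∀ s, D s ≤ 1) (e : Edge n) (x : Edge n → ℝ) :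
    ‖weightedTrace z D x - weightedTrace z D (erase e x)‖ ^ 2 ≤
      x e ^ 2 * (2 * ‖traceSlope z D e (erase e x)‖ ^ 2) +
        (96 * x e ^ 4 + 256 * x e ^ 6) * columnMass D e (green z (erase e x)) := by
  have h1 := norm_weightedTrace_sub_le hz hD0 e x
  have h2 := columnMass_green_le hz hD0 e x
  have h3 := columnMass_le_two hD1 e (norm_green_le_one hz x)
  have h4 := columnMass_le_two hD1 e (norm_green_le_one hz (erase e x))
  have h5 := columnMass_nonneg hD0 e (green z x)
  have h6 := columnMass_nonneg hD0 e (green z (erase e x))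
  set S := columnMass D e (green z x)
  set S' := columnMass D e (green z (erase e x))
  set T := traceSlope z D e (erase e x)
  set δ := weightedTrace z D x - weightedTrace z D (erase e x)
  have h7 : ‖δ‖ ≤ |x e| * ‖T‖ + 2 * x e ^ 2 * (S + S') := by
    have : δ = (δ + (x e : ℂ) * T) - (x e : ℂ) * T := by ring
    rw [this]
    refine (norm_sub_le _ _).trans ?_
    rw [norm_mul, Complex.norm_real, Real.norm_eq_abs]
    linarith
  have h8 := pow_le_pow_left₀ (norm_nonneg _) h7 2
  have h9 : (S + S') ^ 2 ≤ 4 * (S + S') := by nlinarith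
  have h10 := sq_nonneg (|x e| * ‖T‖ - 2 * x e ^ 2 * (S + S'))
  have h11 : x e ^ 4 * (S + S') ^ 2 ≤ x e ^ 4 * (4 * ((3 + 8 * x e ^ 2) * S')) := by
    apply mul_le_mul_of_nonneg_left _ (by positivity)
    linarith
  have h12 : (|x e| * ‖T‖) ^ 2 = x e ^ 2 * ‖T‖ ^ 2 := by rw [mul_pow, sq_abs]
  nlinarith

/-- The erased configuration varies with `e`, whereas the Hilbert–Schmidt bound on the slopes needs
one configuration for all edges. This inequality returns from the former to the latter. -/
theorem norm_traceSlope_erase_sq_le (hz : 1 ≤ |z.im|) (hD0 : ∀ s, 0 ≤ D s)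
    (hD1 : ∀ s, D s ≤ 1) (e : Edge n) (x : Edge n → ℝ) :
    ‖traceSlope z D e (erase e x)‖ ^ 2 ≤ 2 * ‖traceSlope z D e x‖ ^ 2 +
      (864 * x e ^ 2 + 2304 * x e ^ 4) * columnMass D e (green z (erase e x)) := by
  have h1 := norm_traceSlope_sub_le hz hD0 e x
  have h2 := columnMass_green_le hz hD0 e x
  have h3 := columnMass_le_two hD1 e (norm_green_le_one hz x)
  have h4 := columnMass_le_two hD1 e (norm_green_le_one hz (erase e x))
  have h5 := columnMass_nonneg hD0 e (green z x)
  have h6 := columnMass_nonneg hD0 e (green z (erase e x))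
  set S := columnMass D e (green z x)
  set S' := columnMass D e (green z (erase e x))
  have h7 : ‖traceSlope z D e (erase e x)‖ ≤ ‖traceSlope z D e x‖ + 6 * |x e| * (S + S') := by
    have := norm_sub_norm_le (traceSlope z D e (erase e x)) (traceSlope z D e x)
    rw [norm_sub_rev] at this
    linarith
  have h8 := pow_le_pow_left₀ (norm_nonneg _) h7 2
  have h9 : (S + S') ^ 2 ≤ 4 * (S + S') := by nlinarith
  have h10 := sq_nonneg (‖traceSlope z D e x‖ - 6 * |x e| * (S + S'))
  have h11 : x e ^ 2 * (S + S') ^ 2 ≤ x e ^ 2 * (4 * ((3 + 8 * x e ^ 2) * S')) := by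
    apply mul_le_mul_of_nonneg_left _ (by positivity)
    linarith
  have h12 : (|x e| * (S + S')) ^ 2 = x e ^ 2 * (S + S') ^ 2 := by rw [mul_pow, sq_abs]
  nlinarith

/-- Where `4 x² ≤ 1`, multiply the comparison of masses by `1 - 4 x²` and use `(1 - 4 x²)(2 + 8 x²)
≤ 2`; elsewhere the last term alone suffices. The point is that `x e` multiplies only the erased
mass, of which it is independent. -/
theorem one_sub_mul_columnMass_erase_le (hz : 1 ≤ |z.im|) (hD0 : ∀ s, 0 ≤ D s) (e : Edge n)
    (x : Edge n → ℝ) :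
    columnMass D e (green z (erase e x)) ≤ 2 * columnMass D e (green z x) +
      4 * x e ^ 2 * columnMass D e (green z (erase e x)) := by
  have h1 := columnMass_green_erase_le hz hD0 e x
  have h5 := columnMass_nonneg hD0 e (green z x)
  have h6 := columnMass_nonneg hD0 e (green z (erase e x))
  set S := columnMass D e (green z x)
  set S' := columnMass D e (green z (erase e x))
  rcases le_total (4 * x e ^ 2) 1 with h | h
  · have h2 := mul_le_mul_of_nonneg_left h1 (sub_nonneg.2 h)
    have h3 : 0 ≤ x e ^ 4 * S := by positivity
    nlinarith
  · nlinarith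

theorem sum_norm_traceSlope_sq_le (hz : 1 ≤ |z.im|) (hD0 : ∀ s, 0 ≤ D s)
    (hD1 : ∀ s, D s ≤ 1) (x : Edge n → ℝ) :
    ∑ e, ‖traceSlope z D e x‖ ^ 2 ≤ 2 * ∑ s, D s := by
  have h1 : ∀ e, ‖traceSlope z D e x‖ ^ 2 ≤ 2 * ∑ p ∈ pairs e,
      ‖(green z x * Matrix.diagonal (fun s => (D s : ℂ)) * green z x) p.2 p.1‖ ^ 2 := fun e =>
    (pow_le_pow_left₀ (norm_nonneg _) (norm_sum_le _ _) 2).trans (sum_sq_le_two_mul e _)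
  refine (Finset.sum_le_sum fun e _ => h1 e).trans ?_
  rw [← Finset.mul_sum, sum_pairs (fun _ p =>
    ‖(green z x * Matrix.diagonal (fun s => (D s : ℂ)) * green z x) p.2 p.1‖ ^ 2), Finset.sum_comm]
  exact mul_le_mul_of_nonneg_left
    (sum_norm_sq_mul_diagonal_mul_le (norm_green_le_one hz x) hD0 hD1) zero_le_two

/-- Summing over the edges first along a row uses the bound on `p`; what is left is a sum of squared
row lengths of the resolvent, each at most one. -/
theorem sum_mul_columnMass_le (hz : 1 ≤ |z.im|) (hD0 : ∀ s, 0 ≤ D s)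
    {p : Edge n → ℝ} {B : ℝ} (hp : ∀ i, ∑ j, p (edge i j) ≤ B) (hB : 0 ≤ B) (x : Edge n → ℝ) :
    ∑ e, p e * columnMass D e (green z x) ≤ B * ∑ s, D s := by
  simp only [columnMass, Finset.mul_sum (pairs _)]
  rw [sum_pairs (fun e q => p e * ∑ s, D s * ‖green z x s q.1‖ ^ 2)]
  calc ∑ i, ∑ j, p (edge i j) * ∑ s, D s * ‖green z x s i‖ ^ 2
      ≤ ∑ i, B * ∑ s, D s * ‖green z x s i‖ ^ 2 := by
        refine Finset.sum_le_sum fun i _ => ?_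
        rw [← Finset.sum_mul]
        exact mul_le_mul_of_nonneg_right (hp i)
          (Finset.sum_nonneg fun s _ => mul_nonneg (hD0 s) (by positivity))
    _ = B * ∑ s, D s * ∑ i, ‖green z x s i‖ ^ 2 := by
        rw [← Finset.mul_sum, Finset.sum_comm]
        simp only [Finset.mul_sum]
    _ ≤ B * ∑ s, D s := by
        refine mul_le_mul_of_nonneg_left (Finset.sum_le_sum fun s _ => ?_) hB
        exact mul_le_of_le_one_right (hD0 s) ((sum_norm_row_sq_le _ s).trans
          (pow_le_one₀ (norm_nonneg _) (norm_green_le_one hz x)))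

end Deterministic

/-- A probability law on the line with vanishing first and third moments and the prescribed
second, fourth and sixth moments. -/
structure MomentData (ρ : Measure ℝ) (w m₄ m₆ : ℝ) : Prop where
  integrable_six : Integrable (fun y => y ^ 6) ρ
  one : ∫ y, y ∂ρ = 0
  two : ∫ y, y ^ 2 ∂ρ = w
  three : ∫ y, y ^ 3 ∂ρ = 0
  four : ∫ y, y ^ 4 ∂ρ = m₄
  six : ∫ y, y ^ 6 ∂ρ = m₆
  -- Jensen's inequality for a probability law, recorded so that errors quadratic in `w` can be
  -- absorbed into `m₄`.
  sq_le : w ^ 2 ≤ m₄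

namespace MomentData

variable {ρ : Measure ℝ} {w m₄ m₆ : ℝ}

theorem integrable_pow [IsProbabilityMeasure ρ] (h : MomentData ρ w m₄ m₆) {k : ℕ} (hk : k ≤ 6) :
    Integrable (fun y => y ^ k) ρ := by
  refine ((integrable_const (1 : ℝ)).add h.integrable_six.abs).mono'
    (continuous_pow k).aestronglyMeasurable (Filter.Eventually.of_forall fun y => ?_)
  simp only [Pi.add_apply, Real.norm_eq_abs, abs_pow]
  rcases le_total |y| 1 with h1 | h1
  · have := pow_le_one₀ (n := k) (abs_nonneg y) h1
    have : 0 ≤ |y| ^ 6 := by positivity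
    linarith
  · have := pow_le_pow_right₀ h1 hk
    linarith

theorem two_nonneg (h : MomentData ρ w m₄ m₆) : 0 ≤ w := by
  rw [← h.two]; exact integral_nonneg fun y => by positivity

theorem four_nonneg (h : MomentData ρ w m₄ m₆) : 0 ≤ m₄ := by
  rw [← h.four]; exact integral_nonneg fun y => by positivity

theorem six_nonneg (h : MomentData ρ w m₄ m₆) : 0 ≤ m₆ := by
  rw [← h.six]; exact integral_nonneg fun y => by positivity

end MomentData

theorem integrable_of_continuous_of_bound {α E : Type*} [TopologicalSpace α]
    [MeasurableSpace α] [OpensMeasurableSpace α] [NormedAddCommGroup E]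
    [SecondCountableTopologyEither α E]
    {μ : Measure α} [IsFiniteMeasure μ] {F : α → E} (hF : Continuous F) {C : ℝ}
    (hC : ∀ x, ‖F x‖ ≤ C) : Integrable F μ :=
  Integrable.of_bound hF.aestronglyMeasurable C (Filter.Eventually.of_forall hC)

/-! ### Variance of weighted traces of the resolvent -/

section Variance

variable {n : ℕ} {D : Site n → ℝ} {z : ℂ} (ρ : Edge n → Measure ℝ)
  [∀ e, IsProbabilityMeasure (ρ e)]

theorem continuous_green_apply (hz : 0 < |z.im|) (i j : Site n) :
    Continuous fun x : Edge n → ℝ => green z x i j :=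
  (continuous_green hz).matrix_elem i j

theorem continuous_weightedTrace (hz : 0 < |z.im|) : Continuous (weightedTrace z D) :=
  continuous_finsetSum _ fun s _ => continuous_const.mul (continuous_green_apply hz s s)

theorem continuous_traceSlope (hz : 0 < |z.im|) (e : Edge n) :
    Continuous (traceSlope z D e) :=
  continuous_finsetSum _ fun _ _ =>
    (((continuous_green hz).matrix_mul continuous_const).matrix_mul
      (continuous_green hz)).matrix_elem _ _

theorem continuous_columnMass (hz : 0 < |z.im|) (e : Edge n) :
    Continuous fun x => columnMass D e (green z x) :=
  continuous_finsetSum _ fun _ _ => continuous_finsetSum _ fun _ _ =>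
    continuous_const.mul ((continuous_green_apply hz _ _).norm.pow 2)

theorem norm_weightedTrace_le (hz : 1 ≤ |z.im|) (hD0 : ∀ s, 0 ≤ D s) (x : Edge n → ℝ) :
    ‖weightedTrace z D x‖ ≤ ∑ s, D s := by
  refine norm_sum_le_of_le _ fun s _ => ?_
  rw [norm_mul, Complex.norm_real, Real.norm_of_nonneg (hD0 s)]
  exact mul_le_of_le_one_right (hD0 s) ((norm_entry_le _ s s).trans (norm_green_le_one hz x))

theorem boundedMeasurable_weightedTrace (hz : 1 ≤ |z.im|) (hD0 : ∀ s, 0 ≤ D s) :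
    BoundedMeasurable (weightedTrace z D) :=
  ⟨(continuous_weightedTrace (by linarith)).measurable, _, norm_weightedTrace_le hz hD0⟩

theorem norm_traceSlope_sq_le (hz : 1 ≤ |z.im|) (hD0 : ∀ s, 0 ≤ D s) (hD1 : ∀ s, D s ≤ 1)
    (e : Edge n) (x : Edge n → ℝ) : ‖traceSlope z D e x‖ ^ 2 ≤ 2 * ∑ s, D s :=
  (Finset.single_le_sum (f := fun e => ‖traceSlope z D e x‖ ^ 2) (fun _ _ => by positivity)
    (Finset.mem_univ e)).trans (sum_norm_traceSlope_sq_le hz hD0 hD1 x)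

/-- The three pointwise estimates are integrated, with `x e` independent of everything evaluated at
`erase e x`; then the erased mass and slope are traded for the full ones. -/
theorem integral_norm_weightedTrace_sub_sq_le (hz : 1 ≤ |z.im|) (hD0 : ∀ s, 0 ≤ D s)
    (hD1 : ∀ s, D s ≤ 1) {e : Edge n} {w m₄ m₆ : ℝ} (hρ : MomentData (ρ e) w m₄ m₆)
    (hw : w ≤ 1 / 8) :
    ∫ x, ‖weightedTrace z D x - weightedTrace z D (erase e x)‖ ^ 2 ∂(Measure.pi ρ) ≤
      4 * w * ∫ x, ‖traceSlope z D e x‖ ^ 2 ∂(Measure.pi ρ) +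
        60000 * (m₄ + m₆) * ∫ x, columnMass D e (green z x) ∂(Measure.pi ρ) := by
  have hz0 : 0 < |z.im| := by linarith
  set ν := Measure.pi ρ with hν
  set T : (Edge n → ℝ) → ℝ := fun x => ‖traceSlope z D e x‖ ^ 2 with hT
  set S : (Edge n → ℝ) → ℝ := fun x => columnMass D e (green z x) with hS
  have hTc : Continuous T := (continuous_traceSlope hz0 e).norm.pow 2
  have hSc : Continuous S := continuous_columnMass hz0 e
  have hTb : ∀ x, ‖T x‖ ≤ 2 * ∑ s, D s := fun x => by
    rw [Real.norm_of_nonneg (by positivity)]; exact norm_traceSlope_sq_le hz hD0 hD1 e x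
  have hS0 : ∀ x, 0 ≤ S x := fun x => columnMass_nonneg hD0 e _
  have hSb : ∀ x, ‖S x‖ ≤ 2 := fun x => by
    rw [Real.norm_of_nonneg (hS0 x)]; exact columnMass_le_two hD1 e (norm_green_le_one hz x)
  have hTi : Integrable T ν := integrable_of_continuous_of_bound hTc hTb
  have hSi : Integrable S ν := integrable_of_continuous_of_bound hSc hSb
  have hTi' : Integrable (fun x => T (erase e x)) ν :=
    integrable_of_continuous_of_bound (hTc.comp (continuous_erase e)) fun x => hTb _
  have hSi' : Integrable (fun x => S (erase e x)) ν :=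
    integrable_of_continuous_of_bound (hSc.comp (continuous_erase e)) fun x => hSb _
  have hi : ∀ {k : ℕ}, k ≤ 6 → ∀ {K : (Edge n → ℝ) → ℝ}, Continuous K →
      Integrable (fun x => K (erase e x)) ν → Integrable (fun x => x e ^ k * K (erase e x)) ν :=
    fun hk K hK hKi => integrable_mul_update ρ e (hρ.integrable_pow hk) hKi
      (continuous_pow _).measurable hK.measurable
  have hI : ∀ (k : ℕ) {K : (Edge n → ℝ) → ℝ}, Continuous K →
      ∫ x, x e ^ k * K (erase e x) ∂ν = (∫ y, y ^ k ∂(ρ e)) * ∫ x, K (erase e x) ∂ν :=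
    fun k K hK => integral_mul_update ρ e (continuous_pow k).measurable hK.measurable
  have a1 : ∫ x, ‖weightedTrace z D x - weightedTrace z D (erase e x)‖ ^ 2 ∂ν ≤
      2 * w * ∫ x, T (erase e x) ∂ν + (96 * m₄ + 256 * m₆) * ∫ x, S (erase e x) ∂ν := by
    have h1 : Integrable (fun x => 2 * (x e ^ 2 * T (erase e x)) +
        (96 * (x e ^ 4 * S (erase e x)) + 256 * (x e ^ 6 * S (erase e x)))) ν :=
      ((hi (by norm_num) hTc hTi').const_mul 2).add
        (((hi (by norm_num) hSc hSi').const_mul 96).add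
          ((hi (by norm_num) hSc hSi').const_mul 256))
    have h2 : BoundedMeasurable
        (fun x => weightedTrace z D x - weightedTrace z D (erase e x)) :=
      (boundedMeasurable_weightedTrace hz hD0).sub
        ((boundedMeasurable_weightedTrace hz hD0).comp (continuous_erase e).measurable)
    refine (integral_mono h2.integrable_sq h1 fun x => ?_).trans (le_of_eq ?_)
    · have := norm_weightedTrace_sub_sq_le hz hD0 hD1 e x
      simp only [hT, hS]
      linarith
    · rw [integral_add, integral_add, integral_const_mul, integral_const_mul, integral_const_mul,
        hI 2 hTc, hI 4 hSc, hI 6 hSc, hρ.two, hρ.four, hρ.six]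
      · ring
      · exact (hi (by norm_num) hSc hSi').const_mul 96
      · exact (hi (by norm_num) hSc hSi').const_mul 256
      · exact (hi (by norm_num) hTc hTi').const_mul 2
      · exact ((hi (by norm_num) hSc hSi').const_mul 96).add
          ((hi (by norm_num) hSc hSi').const_mul 256)
  have a2 : ∫ x, T (erase e x) ∂ν ≤
      2 * ∫ x, T x ∂ν + (864 * w + 2304 * m₄) * ∫ x, S (erase e x) ∂ν := by
    have h1 : Integrable (fun x => 2 * T x +
        (864 * (x e ^ 2 * S (erase e x)) + 2304 * (x e ^ 4 * S (erase e x)))) ν :=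
      (hTi.const_mul 2).add
        (((hi (by norm_num) hSc hSi').const_mul 864).add
          ((hi (by norm_num) hSc hSi').const_mul 2304))
    refine (integral_mono hTi' h1 fun x => ?_).trans (le_of_eq ?_)
    · have := norm_traceSlope_erase_sq_le hz hD0 hD1 e x
      simp only [hT, hS]
      linarith
    · rw [integral_add, integral_add, integral_const_mul, integral_const_mul, integral_const_mul,
        hI 2 hSc, hI 4 hSc, hρ.two, hρ.four]
      · ring
      · exact (hi (by norm_num) hSc hSi').const_mul 864
      · exact (hi (by norm_num) hSc hSi').const_mul 2304
      · exact hTi.const_mul 2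
      · exact ((hi (by norm_num) hSc hSi').const_mul 864).add
          ((hi (by norm_num) hSc hSi').const_mul 2304)
  have a3 : ∫ x, S (erase e x) ∂ν ≤ 2 * ∫ x, S x ∂ν + 4 * w * ∫ x, S (erase e x) ∂ν := by
    have h1 : Integrable (fun x => 2 * S x + 4 * (x e ^ 2 * S (erase e x))) ν :=
      (hSi.const_mul 2).add ((hi (by norm_num) hSc hSi').const_mul 4)
    refine (integral_mono hSi' h1 fun x => ?_).trans (le_of_eq ?_)
    · have := one_sub_mul_columnMass_erase_le hz hD0 e x
      simp only [hS]
      linarith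
    · rw [integral_add, integral_const_mul, integral_const_mul, hI 2 hSc, hρ.two]
      · ring
      · exact hSi.const_mul 2
      · exact (hi (by norm_num) hSc hSi').const_mul 4
  have hw0 := hρ.two_nonneg
  have h40 := hρ.four_nonneg
  have h60 := hρ.six_nonneg
  have hsq := hρ.sq_le
  have hs0 : 0 ≤ ∫ x, S (erase e x) ∂ν := integral_nonneg fun x => hS0 _
  set s' := ∫ x, S (erase e x) ∂ν
  set s := ∫ x, S x ∂ν
  set t := ∫ x, T x ∂ν
  -- As `w ≤ 1 / 8`, the term `4 * w * s'` in `a3` is at most `s' / 2` and is absorbed on the left.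
  have a4 : s' ≤ 4 * s := by nlinarith
  -- From `w ^ 2 ≤ m₄` and `w ≤ 1 / 8`: `1728 w² + 4608 w m₄ ≤ 1728 m₄ + 576 m₄`.
  have a5 : 2 * w * (864 * w + 2304 * m₄) ≤ 2304 * m₄ := by nlinarith
  have a6 := mul_le_mul_of_nonneg_left a2 (by positivity : 0 ≤ 2 * w)
  have a7 := mul_le_mul_of_nonneg_right a5 hs0
  have a8 : (2304 * m₄ + (96 * m₄ + 256 * m₆)) * s' ≤ (15000 * (m₄ + m₆)) * (4 * s) :=
    mul_le_mul (by nlinarith) a4 hs0 (by positivity)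
  linarith

/-- The variance of a weighted trace of the resolvent of a random band matrix. -/
theorem variance_weightedTrace_le (hz : 1 ≤ |z.im|) (hD0 : ∀ s, 0 ≤ D s)
    (hD1 : ∀ s, D s ≤ 1) {b v : ℝ} {p : Edge n → ℝ} (hb : 1 ≤ b) (hbv : 8 * v ^ 2 ≤ b)
    (hp0 : ∀ e, 0 ≤ p e) (hp1 : ∀ e, p e ≤ 1) (hp : ∀ i, ∑ j, p (edge i j) ≤ b + 1)
    (hρ : ∀ e, MomentData (ρ e) (v ^ 2 * p e / b) (3 * v ^ 4 * p e / b ^ 2)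
      (15 * v ^ 6 * p e / b ^ 3)) :
    ∫ x, ‖weightedTrace z D x - ∫ u, weightedTrace z D u ∂(Measure.pi ρ)‖ ^ 2 ∂(Measure.pi ρ) ≤
      (8 * v ^ 2 + 120000 * (3 * v ^ 4 + 15 * v ^ 6)) / b * ∑ s, D s := by
  have hz0 : 0 < |z.im| := by linarith
  have hb0 : 0 < b := by linarith
  set ν := Measure.pi ρ with hν
  refine (efron_stein ρ (boundedMeasurable_weightedTrace hz hD0)).trans ?_
  have hSD : 0 ≤ ∑ s, D s := Finset.sum_nonneg fun s _ => hD0 s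
  have hTi : ∀ e, Integrable (fun x => ‖traceSlope z D e x‖ ^ 2) ν := fun e =>
    integrable_of_continuous_of_bound ((continuous_traceSlope hz0 e).norm.pow 2)
      fun x => by
        rw [Real.norm_of_nonneg (by positivity)]
        exact norm_traceSlope_sq_le hz hD0 hD1 e x
  have hSi : ∀ e, Integrable (fun x => columnMass D e (green z x)) ν := fun e =>
    integrable_of_continuous_of_bound (continuous_columnMass hz0 e) (C := 2) fun x => by
      rw [Real.norm_of_nonneg (columnMass_nonneg hD0 e _)]
      exact columnMass_le_two hD1 e (norm_green_le_one hz x)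
  have hconst : ∀ c : ℝ, ∫ _, c ∂ν = c := fun c => by simp
  have h1 : ∀ e, ∫ x, ‖weightedTrace z D x - weightedTrace z D (erase e x)‖ ^ 2 ∂ν ≤
      4 * v ^ 2 / b * ∫ x, ‖traceSlope z D e x‖ ^ 2 ∂ν +
        60000 * (3 * v ^ 4 + 15 * v ^ 6) / b ^ 2 *
          (p e * ∫ x, columnMass D e (green z x) ∂ν) := by
    intro e
    have hw : v ^ 2 * p e / b ≤ v ^ 2 / b := by
      gcongr; exact mul_le_of_le_one_right (by positivity) (hp1 e)
    have hw8 : v ^ 2 / b ≤ 1 / 8 := by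
      rw [div_le_iff₀ hb0]; linarith
    refine (integral_norm_weightedTrace_sub_sq_le ρ hz hD0 hD1 (hρ e) (hw.trans hw8)).trans ?_
    have hT0 : 0 ≤ ∫ x, ‖traceSlope z D e x‖ ^ 2 ∂ν := integral_nonneg fun x => by positivity
    have hS0 : 0 ≤ ∫ x, columnMass D e (green z x) ∂ν :=
      integral_nonneg fun x => columnMass_nonneg hD0 e _
    have h2 : 15 * v ^ 6 * p e / b ^ 3 ≤ 15 * v ^ 6 * p e / b ^ 2 := by
      have h3 := hp0 e
      have h6 : 0 ≤ v ^ 6 := by positivity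
      exact div_le_div_of_nonneg_left (by positivity) (by positivity)
        (pow_le_pow_right₀ hb (by norm_num))
    have h3 := mul_le_mul_of_nonneg_right hw hT0
    have h4 := mul_le_mul_of_nonneg_right h2 hS0
    have h5 : 60000 * (3 * v ^ 4 + 15 * v ^ 6) / b ^ 2 *
          (p e * ∫ x, columnMass D e (green z x) ∂ν) =
        60000 * ((3 * v ^ 4 * p e / b ^ 2) * (∫ x, columnMass D e (green z x) ∂ν) +
          (15 * v ^ 6 * p e / b ^ 2) * (∫ x, columnMass D e (green z x) ∂ν)) := by ring
    have h6 : 4 * v ^ 2 / b * ∫ x, ‖traceSlope z D e x‖ ^ 2 ∂ν =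
      4 * (v ^ 2 / b * ∫ x, ‖traceSlope z D e x‖ ^ 2 ∂ν) := by ring
    rw [h5, h6]
    linarith
  refine (Finset.sum_le_sum fun e _ => h1 e).trans ?_
  rw [Finset.sum_add_distrib, ← Finset.mul_sum, ← Finset.mul_sum]
  -- For the linear term the crude bound `v ^ 2 / b` on the variance of every entry is enough.
  have h2 : ∑ e, ∫ x, ‖traceSlope z D e x‖ ^ 2 ∂ν ≤ 2 * ∑ s, D s := by
    rw [← integral_finsetSum _ fun e _ => hTi e, ← hconst (2 * ∑ s, D s)]
    exact integral_mono (integrable_finsetSum _ fun e _ => hTi e) (integrable_const _)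
      fun x => sum_norm_traceSlope_sq_le hz hD0 hD1 x
  -- For the remainder the factor `p e` must be kept: summed along a row it gives at most `2 * b`,
  -- which cancels one power of the prefactor `1 / b ^ 2`.
  have h3 : ∑ e, p e * ∫ x, columnMass D e (green z x) ∂ν ≤ 2 * b * ∑ s, D s := by
    simp only [← integral_const_mul]
    rw [← integral_finsetSum _ fun e _ => (hSi e).const_mul _, ← hconst (2 * b * ∑ s, D s)]
    exact integral_mono (integrable_finsetSum _ fun e _ => (hSi e).const_mul _)
      (integrable_const _) fun x => sum_mul_columnMass_le hz hD0
        (fun i => (hp i).trans (by linarith)) (by linarith) x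
  have h4 := mul_le_mul_of_nonneg_left h2 (by positivity : 0 ≤ 4 * v ^ 2 / b)
  have h5 := mul_le_mul_of_nonneg_left h3
    (by positivity : 0 ≤ 60000 * (3 * v ^ 4 + 15 * v ^ 6) / b ^ 2)
  refine (add_le_add h4 h5).trans (le_of_eq ?_)
  field_simp
  ring

end Variance

/-! ### First-order expansions in one coordinate with quadratic remainder -/

section Jet

variable {n : ℕ} {R : Type*} [NormedRing R] [NormedAlgebra ℂ R]

/-- `Y` is bounded and has a first-order expansion in the coordinate `e` around `0`, with a
quadratic remainder, all with the constant `K` uniformly in the other coordinates. -/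
def HasJet (e : Edge n) (K : ℝ) (Y : (Edge n → ℝ) → R) : Prop :=
  Continuous Y ∧ (∀ x, ‖Y x‖ ≤ K) ∧ (∀ x, ‖Y x - Y (erase e x)‖ ≤ K * |x e|) ∧
    ∃ Y₁ : (Edge n → ℝ) → R, Continuous Y₁ ∧ (∀ x, ‖Y₁ x‖ ≤ K) ∧
      ∀ x, ‖Y x - Y (erase e x) - (x e : ℂ) • Y₁ (erase e x)‖ ≤ K * x e ^ 2

namespace HasJet

variable {e : Edge n} {K L : ℝ} {Y Z : (Edge n → ℝ) → R}

theorem nonneg (hY : HasJet e K Y) : 0 ≤ K := (norm_nonneg _).trans (hY.2.1 0)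

theorem mono (hY : HasJet e K Y) (hKL : K ≤ L) : HasJet e L Y := by
  obtain ⟨h1, h2, h3, Y₁, h4, h5, h6⟩ := hY
  exact ⟨h1, fun x => (h2 x).trans hKL, fun x => (h3 x).trans (by gcongr), Y₁, h4,
    fun x => (h5 x).trans hKL, fun x => (h6 x).trans (by gcongr)⟩

theorem of_erase (hY : Continuous Y) (hK : ∀ x, ‖Y x‖ ≤ K)
    (he : ∀ x, Y (erase e x) = Y x) : HasJet e K Y := by
  have h0 : 0 ≤ K := (norm_nonneg _).trans (hK 0)
  refine ⟨hY, hK, fun x => ?_, 0, continuous_const, fun x => ?_, fun x => ?_⟩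
  · rw [he, sub_self, norm_zero]; positivity
  · simpa using h0
  · rw [he, sub_self]; simp; positivity

theorem add (hY : HasJet e K Y) (hZ : HasJet e L Z) : HasJet e (K + L) fun x => Y x + Z x := by
  obtain ⟨h1, h2, h3, Y₁, h4, h5, h6⟩ := hY
  obtain ⟨g1, g2, g3, Z₁, g4, g5, g6⟩ := hZ
  refine ⟨h1.add g1, fun x => (norm_add_le _ _).trans (add_le_add (h2 x) (g2 x)), fun x => ?_,
    fun x => Y₁ x + Z₁ x, h4.add g4, fun x => (norm_add_le _ _).trans (add_le_add (h5 x) (g5 x)),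
    fun x => ?_⟩
  · rw [add_sub_add_comm, add_mul]
    exact (norm_add_le _ _).trans (add_le_add (h3 x) (g3 x))
  · rw [add_sub_add_comm, smul_add, add_sub_add_comm, add_mul]
    exact (norm_add_le _ _).trans (add_le_add (h6 x) (g6 x))

theorem neg (hY : HasJet e K Y) : HasJet e K fun x => -Y x := by
  obtain ⟨h1, h2, h3, Y₁, h4, h5, h6⟩ := hY
  refine ⟨h1.neg, fun x => by rw [norm_neg]; exact h2 x, fun x => ?_,
    fun x => -Y₁ x, h4.neg, fun x => by rw [norm_neg]; exact h5 x, fun x => ?_⟩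
  · rw [← neg_sub', norm_neg]; exact h3 x
  · rw [← neg_sub', smul_neg, ← neg_sub', norm_neg]; exact h6 x

/-- The `3` counts the terms of the second-order remainder. The mixed term `x * Y₁ * (Z - Z(erase))`
is quadratic only because `Z` is Lipschitz, which is why the definition contains a Lipschitz clause.
-/
theorem mul (hY : HasJet e K Y) (hZ : HasJet e L Z) : HasJet e (3 * K * L) fun x => Y x * Z x := by
  have hK := hY.nonneg
  have hL := hZ.nonneg
  obtain ⟨h1, h2, h3, Y₁, h4, h5, h6⟩ := hY
  obtain ⟨g1, g2, g3, Z₁, g4, g5, g6⟩ := hZ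
  have hKL : 0 ≤ K * L := mul_nonneg hK hL
  have hm : ∀ {a b : R} {A B : ℝ}, 0 ≤ A → ‖a‖ ≤ A → ‖b‖ ≤ B → ‖a * b‖ ≤ A * B :=
    fun hA ha hb => (norm_mul_le _ _).trans (mul_le_mul ha hb (norm_nonneg _) hA)
  refine ⟨h1.mul g1, fun x => (hm hK (h2 x) (g2 x)).trans (by linarith), fun x => ?_,
    fun x => Y x * Z₁ x + Y₁ x * Z x, (h1.mul g4).add (h4.mul g1), fun x => ?_, fun x => ?_⟩
  · have : Y x * Z x - Y (erase e x) * Z (erase e x) =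
        (Y x - Y (erase e x)) * Z x + Y (erase e x) * (Z x - Z (erase e x)) := by noncomm_ring
    rw [this]
    have a1 := hm (by positivity) (h3 x) (g2 x)
    have a2 := hm hK (h2 (erase e x)) (g3 x)
    have a3 : 0 ≤ K * L * |x e| := by positivity
    refine (norm_add_le _ _).trans ((add_le_add a1 a2).trans ?_)
    linarith
  · have a1 := hm hK (h2 x) (g5 x)
    have a2 := hm hK (h5 x) (g2 x)
    refine (norm_add_le _ _).trans ((add_le_add a1 a2).trans ?_)
    linarith
  · have : Y x * Z x - Y (erase e x) * Z (erase e x) - (x e : ℂ) •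
          (Y (erase e x) * Z₁ (erase e x) + Y₁ (erase e x) * Z (erase e x)) =
        (Y x - Y (erase e x) - (x e : ℂ) • Y₁ (erase e x)) * Z x +
          Y (erase e x) * (Z x - Z (erase e x) - (x e : ℂ) • Z₁ (erase e x)) +
          (x e : ℂ) • (Y₁ (erase e x) * (Z x - Z (erase e x))) := by
      simp only [smul_add, sub_mul, mul_sub, smul_mul_assoc, mul_smul_comm, smul_sub]
      abel
    rw [this]
    have a1 := hm (by positivity) (h6 x) (g2 x)
    have a2 := hm hK (h2 (erase e x)) (g6 x)
    have a3 := mul_le_mul_of_nonneg_left (hm hK (h5 (erase e x)) (g3 x)) (abs_nonneg (x e))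
    have a4 : ‖(x e : ℂ) • (Y₁ (erase e x) * (Z x - Z (erase e x)))‖ ≤ K * L * x e ^ 2 := by
      rw [norm_smul, Complex.norm_real, Real.norm_eq_abs]
      refine a3.trans (le_of_eq ?_)
      rw [← sq_abs (x e)]; ring
    refine (norm_add_le _ _).trans ((add_le_add ((norm_add_le _ _).trans
      (add_le_add a1 a2)) a4).trans ?_)
    linarith

theorem boundedMeasurable {Y : (Edge n → ℝ) → ℂ} (hY : HasJet e K Y) : BoundedMeasurable Y :=
  ⟨hY.1.measurable, K, hY.2.1⟩

theorem sum_pairs {Y : Site n × Site n → (Edge n → ℝ) → R}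
    (hY : ∀ p ∈ pairs e, HasJet e K (Y p)) (hK : 0 ≤ K) :
    HasJet e (2 * K) fun x => ∑ p ∈ pairs e, Y p x := by
  have h : ∀ s : Finset (Site n × Site n), s ⊆ pairs e →
      HasJet e (s.card * K) fun x => ∑ p ∈ s, Y p x := by
    classical
    intro s
    induction s using Finset.induction_on with
    | empty =>
      intro _
      simpa using of_erase (Y := fun _ => (0 : R)) (K := 0) (e := e) continuous_const
        (by simp) (by simp)
    | insert a s ha ih =>
      intro hs
      have := (hY a (hs (Finset.mem_insert_self _ _))).add
        (ih fun p hp => hs (Finset.mem_insert_of_mem hp))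
      simp only [Finset.sum_insert ha, Finset.card_insert_of_notMem ha]
      refine this.mono (le_of_eq ?_)
      push_cast; ring
  have h2 : ((pairs e).card : ℝ) ≤ 2 := by exact_mod_cast card_pairs_le e
  exact (h _ subset_rfl).mono (by gcongr)

theorem entry {A : (Edge n → ℝ) → Matrix (Site n) (Site n) ℂ} (hA : HasJet e K A)
    (i j : Site n) : HasJet e K fun x => A x i j := by
  obtain ⟨h1, h2, h3, Y₁, h4, h5, h6⟩ := hA
  exact ⟨h1.matrix_elem i j, fun x => (norm_entry_le _ i j).trans (h2 x),
    fun x => (norm_entry_le (A x - A (erase e x)) i j).trans (h3 x), fun x => Y₁ x i j,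
    h4.matrix_elem i j, fun x => (norm_entry_le _ i j).trans (h5 x),
    fun x => (norm_entry_le (A x - A (erase e x) - (x e : ℂ) • Y₁ (erase e x)) i j).trans (h6 x)⟩

end HasJet

variable {z : ℂ}

/-- The derivative is `-G * bump e * G`. With `‖bump e‖ ≤ 2` the resolvent identity gives Lipschitz
constant `2`, and used again it gives the quadratic constant `2 * 2`. -/
theorem hasJet_green (hz : 1 ≤ |z.im|) (e : Edge n) : HasJet e 4 (green z) := by
  have hz0 : 0 < |z.im| := by linarith
  have hm : ∀ {a b : Matrix (Site n) (Site n) ℂ} {A B : ℝ}, 0 ≤ A → ‖a‖ ≤ A → ‖b‖ ≤ B →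
      ‖a * b‖ ≤ A * B :=
    fun hA ha hb => (norm_mul_le _ _).trans (mul_le_mul ha hb (norm_nonneg _) hA)
  have hG := norm_green_le_one (n := n) hz
  have hPB : ∀ x, ‖green z x * bump e‖ ≤ 1 * 2 := fun x => hm zero_le_one (hG x) (norm_bump_le e)
  have h1 : ∀ x, green z x - green z (erase e x) =
      -((x e : ℂ) • (green z (erase e x) * bump e * green z x)) := by
    intro x
    conv_lhs => rw [green_sub hz0 x e]
    abel
  have h2 : ∀ x, ‖green z x - green z (erase e x)‖ ≤ 2 * |x e| := by
    intro x
    have := hm (by norm_num) (hPB (erase e x)) (hG x)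
    rw [h1, norm_neg, norm_smul, Complex.norm_real, Real.norm_eq_abs, mul_comm]
    exact mul_le_mul_of_nonneg_right (by linarith) (abs_nonneg _)
  refine ⟨continuous_green hz0, fun x => (hG x).trans (by norm_num), fun x => (h2 x).trans ?_,
    fun x => -(green z x * bump e * green z x), ?_, fun x => ?_, fun x => ?_⟩
  · have := abs_nonneg (x e); linarith
  · exact (((continuous_green hz0).mul continuous_const).mul (continuous_green hz0)).neg
  · rw [norm_neg]
    have := hm (by norm_num) (hPB x) (hG x)
    linarith
  · have h3 : green z x - green z (erase e x) - (x e : ℂ) •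
        -(green z (erase e x) * bump e * green z (erase e x)) =
        -((x e : ℂ) • (green z (erase e x) * bump e * (green z x - green z (erase e x)))) := by
      rw [mul_sub, smul_sub, smul_neg, h1 x]
      abel
    have h4 := hm (by norm_num) (hPB (erase e x)) (h2 x)
    rw [h3, norm_neg, norm_smul, Complex.norm_real, Real.norm_eq_abs]
    have h5 := mul_le_mul_of_nonneg_left h4 (abs_nonneg (x e))
    refine h5.trans (le_of_eq ?_)
    rw [← sq_abs (x e)]; ring

end Jet

/-! ### Integration by parts in one entry from matching moments -/

section CumulantExpansion

variable {n : ℕ} (ρ : Edge n → Measure ℝ) [∀ e, IsProbabilityMeasure (ρ e)] {e : Edge n}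
  {w m₄ m₆ : ℝ}

theorem integral_ofReal_pow_mul_erase (e : Edge n) (k : ℕ) {A : (Edge n → ℝ) → ℂ}
    (hA : BoundedMeasurable A) :
    ∫ x, (x e : ℂ) ^ k * A (erase e x) ∂(Measure.pi ρ) =
      ((∫ y, y ^ k ∂(ρ e) : ℝ) : ℂ) * ∫ x, A (erase e x) ∂(Measure.pi ρ) := by
  have hm : Measurable fun y : ℝ => (y : ℂ) ^ k := Complex.measurable_ofReal.pow_const k
  have := integral_mul_update ρ e hm hA.1
  rw [← integral_complex_ofReal]
  push_cast
  exact this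

theorem integrable_ofReal_pow_mul_erase (hρ : MomentData (ρ e) w m₄ m₆) {k : ℕ} (hk : k ≤ 6)
    {A : (Edge n → ℝ) → ℂ} (hA : BoundedMeasurable A) :
    Integrable (fun x => (x e : ℂ) ^ k * A (erase e x)) (Measure.pi ρ) := by
  have hm : Measurable fun y : ℝ => (y : ℂ) ^ k := Complex.measurable_ofReal.pow_const k
  have hi : Integrable (fun y : ℝ => (y : ℂ) ^ k) (ρ e) := by
    have := (hρ.integrable_pow hk).ofReal (𝕜 := ℂ)
    simpa using this
  exact integrable_mul_update ρ e hi (hA.comp measurable_update_left).integrable hm hA.1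

theorem integral_pow_mul_norm_erase (e : Edge n) (k : ℕ) {S : (Edge n → ℝ) → ℝ}
    (hS : Measurable S) :
    ∫ x, x e ^ k * S (erase e x) ∂(Measure.pi ρ) =
      (∫ y, y ^ k ∂(ρ e)) * ∫ x, S (erase e x) ∂(Measure.pi ρ) :=
  integral_mul_update ρ e (measurable_id.pow_const k) hS

/-- Two quantities, one with a third-order and one with a first-order expansion in the coordinate
`e`, whose leading coefficients match. -/
theorem norm_integral_sub_le (hρ : MomentData (ρ e) w m₄ m₆) {Y W A₀ A₁ A₂ A₃ : (Edge n → ℝ) → ℂ}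
    {S : (Edge n → ℝ) → ℝ} (hY : Integrable Y (Measure.pi ρ)) (hW : Integrable W (Measure.pi ρ))
    (h0 : BoundedMeasurable A₀) (h1 : BoundedMeasurable A₁) (h2 : BoundedMeasurable A₂)
    (h3 : BoundedMeasurable A₃) (hS : Measurable S) (hS0 : ∀ x, 0 ≤ S x)
    (hSi : Integrable (fun x => S (erase e x)) (Measure.pi ρ))
    (hYA : ∀ x, ‖Y x - ((x e : ℂ) ^ 1 * A₀ (erase e x) + (x e : ℂ) ^ 2 * A₁ (erase e x) +
      (x e : ℂ) ^ 3 * A₂ (erase e x))‖ ≤ x e ^ 4 * S (erase e x))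
    (hWA : ∀ x, ‖W x - (A₁ (erase e x) + (x e : ℂ) ^ 1 * A₃ (erase e x))‖ ≤
      x e ^ 2 * S (erase e x)) :
    ‖∫ x, Y x ∂(Measure.pi ρ) - (w : ℂ) * ∫ x, W x ∂(Measure.pi ρ)‖ ≤
      2 * m₄ * ∫ x, S (erase e x) ∂(Measure.pi ρ) := by
  set ν := Measure.pi ρ with hν
  have i0 := integrable_ofReal_pow_mul_erase ρ hρ (k := 1) (by norm_num) h0
  have i1 := integrable_ofReal_pow_mul_erase ρ hρ (k := 2) (by norm_num) h1
  have i2 := integrable_ofReal_pow_mul_erase ρ hρ (k := 3) (by norm_num) h2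
  have i3 := integrable_ofReal_pow_mul_erase ρ hρ (k := 1) (by norm_num) h3
  have i1' : Integrable (fun x => A₁ (erase e x)) ν :=
    (h1.comp (continuous_erase e).measurable).integrable
  have hS4 : Integrable (fun x => x e ^ 4 * S (erase e x)) ν :=
    integrable_mul_update ρ e (hρ.integrable_pow (by norm_num)) hSi
      (measurable_id.pow_const 4) hS
  have hS2 : Integrable (fun x => x e ^ 2 * S (erase e x)) ν :=
    integrable_mul_update ρ e (hρ.integrable_pow (by norm_num)) hSi
      (measurable_id.pow_const 2) hS
  have i01 : Integrable (fun x => (x e : ℂ) ^ 1 * A₀ (erase e x) +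
      (x e : ℂ) ^ 2 * A₁ (erase e x)) ν := i0.add i1
  have i012 : Integrable (fun x => (x e : ℂ) ^ 1 * A₀ (erase e x) +
      (x e : ℂ) ^ 2 * A₁ (erase e x) + (x e : ℂ) ^ 3 * A₂ (erase e x)) ν := i01.add i2
  have i13 : Integrable (fun x => A₁ (erase e x) + (x e : ℂ) ^ 1 * A₃ (erase e x)) ν :=
    i1'.add i3
  have hone : ∫ y, y ^ 1 ∂(ρ e) = 0 := by simpa using hρ.one
  -- The first and third moments vanish, so only the quadratic coefficient survives, with weight
  -- `w`.
  have j1 : ∫ x, ((x e : ℂ) ^ 1 * A₀ (erase e x) + (x e : ℂ) ^ 2 * A₁ (erase e x) +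
      (x e : ℂ) ^ 3 * A₂ (erase e x)) ∂ν = (w : ℂ) * ∫ x, A₁ (erase e x) ∂ν := by
    rw [integral_add i01 i2, integral_add i0 i1, integral_ofReal_pow_mul_erase ρ e 1 h0,
      integral_ofReal_pow_mul_erase ρ e 2 h1, integral_ofReal_pow_mul_erase ρ e 3 h2, hone,
      hρ.two, hρ.three]
    simp [hν]
  have j2 : ∫ x, (A₁ (erase e x) + (x e : ℂ) ^ 1 * A₃ (erase e x)) ∂ν =
      ∫ x, A₁ (erase e x) ∂ν := by
    rw [integral_add i1' i3, integral_ofReal_pow_mul_erase ρ e 1 h3, hone]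
    simp
  have k1 : ‖∫ x, Y x ∂ν - (w : ℂ) * ∫ x, A₁ (erase e x) ∂ν‖ ≤
      m₄ * ∫ x, S (erase e x) ∂ν := by
    rw [← j1, ← integral_sub hY i012, ← hρ.four, hν,
      ← integral_pow_mul_norm_erase ρ e 4 hS]
    exact norm_integral_le_of_norm_le hS4 (Filter.Eventually.of_forall hYA)
  -- Passing from `A₁ (erase e x)` back to `W x` costs only second order, since the linear term has
  -- mean zero. After multiplication by `w` this costs `w ^ 2 ≤ m₄`.
  have k2 : ‖∫ x, A₁ (erase e x) ∂ν - ∫ x, W x ∂ν‖ ≤ w * ∫ x, S (erase e x) ∂ν := by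
    rw [norm_sub_rev, ← j2, ← integral_sub hW i13, ← hρ.two, hν,
      ← integral_pow_mul_norm_erase ρ e 2 hS]
    exact norm_integral_le_of_norm_le hS2 (Filter.Eventually.of_forall hWA)
  have hw0 := hρ.two_nonneg
  have k3 : ‖(w : ℂ) * (∫ x, A₁ (erase e x) ∂ν - ∫ x, W x ∂ν)‖ ≤
      m₄ * ∫ x, S (erase e x) ∂ν := by
    rw [norm_mul, Complex.norm_real, Real.norm_of_nonneg hw0]
    have h5 := mul_le_mul_of_nonneg_left k2 hw0
    have hSn' : 0 ≤ ∫ x, S (erase e x) ∂ν := integral_nonneg fun x => hS0 _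
    have h6 := mul_le_mul_of_nonneg_right hρ.sq_le hSn'
    calc _ ≤ w * (w * ∫ x, S (erase e x) ∂ν) := h5
      _ = w ^ 2 * ∫ x, S (erase e x) ∂ν := by ring
      _ ≤ _ := h6
  calc ‖∫ x, Y x ∂ν - (w : ℂ) * ∫ x, W x ∂ν‖
      = ‖(∫ x, Y x ∂ν - (w : ℂ) * ∫ x, A₁ (erase e x) ∂ν) +
          (w : ℂ) * (∫ x, A₁ (erase e x) ∂ν - ∫ x, W x ∂ν)‖ := by congr 1; ring
    _ ≤ _ := (norm_add_le _ _).trans (by linarith)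

theorem integrable_coord_mul (hρ : MomentData (ρ e) w m₄ m₆) {A : (Edge n → ℝ) → ℂ}
    (hA : BoundedMeasurable A) :
    Integrable (fun x => (x e : ℂ) * A x) (Measure.pi ρ) := by
  have h1 : Integrable (fun y : ℝ => (y : ℂ)) (ρ e) := by
    simpa using (hρ.integrable_pow (k := 1) (by norm_num)).ofReal (𝕜 := ℂ)
  have h2 : Integrable (fun x : Edge n → ℝ => (x e : ℂ)) (Measure.pi ρ) :=
    (measurePreserving_eval ρ e).integrable_comp_of_integrable h1
  obtain ⟨C, hC⟩ := hA.2
  exact h2.mul_bdd hA.1.aestronglyMeasurable (Filter.Eventually.of_forall hC)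

/-- Integration by parts in the coordinate `e` for the product of a slowly varying function `γ`
and a function `q`, up to an error governed by the fourth moment. -/
theorem norm_integral_coord_mul_sub_le (hρ : MomentData (ρ e) w m₄ m₆) (hw : w ≤ 1)
    {γ q q' κ u θ : (Edge n → ℝ) → ℂ} {c K : ℝ} (hc : 0 ≤ c) (hγ : BoundedMeasurable γ)
    (hq : HasJet e K q) (hq' : HasJet e K q') (hκ : HasJet e K κ) (hu : HasJet e K u)
    (hθ : HasJet e K θ) (hqq' : ∀ x, q x = q (erase e x) + x e * q' x)
    (hγκ : ∀ x, γ x = γ (erase e x) + x e * (c * κ x))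
    (hq'u : ∀ x, q' (erase e x) = u (erase e x)) (hκθ : ∀ x, κ (erase e x) = θ (erase e x)) :
    ‖∫ x, (x e : ℂ) * (γ x * q x) ∂(Measure.pi ρ) -
        (w : ℂ) * ∫ x, (γ x * u x + c * (θ x * q x)) ∂(Measure.pi ρ)‖ ≤
      2 * m₄ * (K * ∫ x, ‖γ x‖ ∂(Measure.pi ρ) + 7 * K ^ 2 * c) := by
  set ν := Measure.pi ρ with hν
  have hK := hq.nonneg
  have hκq := hκ.mul hq
  have hκu := hκ.mul hu
  have hθq := hθ.mul hq
  obtain ⟨q₁, cq₁, bq₁, rq₁⟩ := hq'.2.2.2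
  obtain ⟨u₁, cu₁, bu₁, ru₁⟩ := hu.2.2.2
  obtain ⟨s₁, cs₁, bs₁, rs₁⟩ := hκq.2.2.2
  obtain ⟨t₁, ct₁, bt₁, rt₁⟩ := hθq.2.2.2
  have hBq := hq.boundedMeasurable
  have hBκ := hκ.boundedMeasurable
  have hBu := hu.boundedMeasurable
  have hBθ := hθ.boundedMeasurable
  have hBc : BoundedMeasurable (fun _ : Edge n → ℝ => (c : ℂ)) := .const _
  have hBq₁ : BoundedMeasurable q₁ := ⟨cq₁.measurable, _, bq₁⟩
  have hBu₁ : BoundedMeasurable u₁ := ⟨cu₁.measurable, _, bu₁⟩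
  have hBs₁ : BoundedMeasurable s₁ := ⟨cs₁.measurable, _, bs₁⟩
  have hBt₁ : BoundedMeasurable t₁ := ⟨ct₁.measurable, _, bt₁⟩
  have hBθq : BoundedMeasurable (fun x => θ x * q x) := hBθ.mul hBq
  have hγe : Integrable (fun x => ‖γ (erase e x)‖) ν :=
    (hγ.comp (continuous_erase e).measurable).integrable.norm
  have hK2 : 0 ≤ K * K := mul_nonneg hK hK
  -- `q'` and `c * κ` are exact difference quotients of `q` and `γ`; `u` and `c * θ` agree with them
  -- at the erased configuration but are intended as the derivatives at `x` itself. So the quadratic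
  -- coefficient of `x e * γ * q` is `W` at the erased configuration, as `A₁` requires.
  have main := norm_integral_sub_le ρ hρ (Y := fun x => (x e : ℂ) * (γ x * q x))
    (W := fun x => γ x * u x + c * (θ x * q x))
    (A₀ := fun x => γ x * q x) (A₁ := fun x => γ x * u x + c * (θ x * q x))
    (A₂ := fun x => γ x * q₁ x + c * s₁ x)
    (A₃ := fun x => γ x * u₁ x + (c * (κ x * u x) + c * t₁ x))
    (S := fun x => K * ‖γ x‖ + 6 * K ^ 2 * c)
    (integrable_coord_mul ρ hρ (hγ.mul hBq))
    ((hγ.mul hBu).add (hBc.mul hBθq)).integrable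
    (hγ.mul hBq) ((hγ.mul hBu).add (hBc.mul hBθq)) ((hγ.mul hBq₁).add (hBc.mul hBs₁))
    ((hγ.mul hBu₁).add ((hBc.mul (hBκ.mul hBu)).add (hBc.mul hBt₁)))
    ((hγ.1.norm.const_mul K).add_const _) (fun x => by positivity)
    ((hγe.const_mul K).add (integrable_const _)) (fun x => ?_) (fun x => ?_)
  · refine main.trans ?_
    -- Restoring the entry in `γ` costs `c * K * |x e|`, and `|x| ≤ (1 + x²) / 2` has mean at most
    -- one because `w ≤ 1`. Multiplied by `K`, this raises `6` to the `7` of the statement.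
    have h1 : ∫ x, ‖γ (erase e x)‖ ∂ν ≤ ∫ x, ‖γ x‖ ∂ν + K * c := by
      have hi2 : Integrable (fun x : Edge n → ℝ => x e ^ 2) ν :=
        (measurePreserving_eval ρ e).integrable_comp_of_integrable
          (hρ.integrable_pow (k := 2) (by norm_num))
      have h2 : ∀ x, ‖γ (erase e x)‖ ≤ ‖γ x‖ + K * c * ((1 + x e ^ 2) / 2) := by
        intro x
        have h3 : γ (erase e x) = γ x - x e * (c * κ x) := by rw [hγκ x]; ring
        rw [h3]
        refine (norm_sub_le _ _).trans (add_le_add le_rfl ?_)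
        rw [norm_mul, norm_mul, Complex.norm_real, Complex.norm_real, Real.norm_eq_abs,
          Real.norm_of_nonneg hc]
        have h4 : |x e| ≤ (1 + x e ^ 2) / 2 := by
          rw [← sq_abs]; nlinarith [sq_nonneg (|x e| - 1)]
        have h5 := mul_le_mul_of_nonneg_left (hκ.2.1 x) hc
        calc |x e| * (c * ‖κ x‖) ≤ ((1 + x e ^ 2) / 2) * (c * K) :=
              mul_le_mul h4 h5 (by positivity) (by positivity)
          _ = _ := by ring
      have h6 : Integrable (fun x => K * c * ((1 + x e ^ 2) / 2)) ν :=
        (((integrable_const 1).add hi2).div_const 2).const_mul _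
      refine (integral_mono hγe (hγ.integrable.norm.add h6) h2).trans ?_
      have h7 : ∫ x, (‖γ x‖ + K * c * ((1 + x e ^ 2) / 2)) ∂ν =
          ∫ x, ‖γ x‖ ∂ν + K * c * ((1 + w) / 2) := by
        rw [integral_add hγ.integrable.norm h6, integral_const_mul, integral_div,
          integral_add (integrable_const _) hi2]
        have h8 : ∫ x, x e ^ 2 ∂ν = w := by
          rw [← hρ.two, hν]
          have := integral_pow_mul_norm_erase ρ e 2 (S := fun _ => 1) measurable_const
          simpa using this
        rw [h8]
        simp
      simp only [Pi.add_apply]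
      rw [h7]
      have : K * c * ((1 + w) / 2) ≤ K * c * 1 :=
        mul_le_mul_of_nonneg_left (by linarith) (by positivity)
      linarith
    refine mul_le_mul_of_nonneg_left ?_ (by have := hρ.four_nonneg; positivity)
    rw [integral_add (hγe.const_mul K) (integrable_const _), integral_const_mul]
    have h2 := mul_le_mul_of_nonneg_left h1 hK
    have h3 : ∫ _, (6 * K ^ 2 * c) ∂ν = 6 * K ^ 2 * c := by simp
    rw [h3]
    linarith
  -- Write `γ q` as `γ(erase) q + x c κ q` and expand `q` in the first summand only. The error then
  -- consists of the jet remainders of `q'` and of `κ * q`.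
  · have h1 : (x e : ℂ) * (γ x * q x) - ((x e : ℂ) ^ 1 * (γ (erase e x) * q (erase e x)) +
        (x e : ℂ) ^ 2 * (γ (erase e x) * u (erase e x) +
          c * (θ (erase e x) * q (erase e x))) +
        (x e : ℂ) ^ 3 * (γ (erase e x) * q₁ (erase e x) + c * s₁ (erase e x))) =
        (x e : ℂ) ^ 2 * (γ (erase e x) *
            (q' x - q' (erase e x) - (x e : ℂ) • q₁ (erase e x)) +
          c * (κ x * q x - κ (erase e x) * q (erase e x) - (x e : ℂ) • s₁ (erase e x))) := by
      rw [← hq'u, ← hκθ, smul_eq_mul, smul_eq_mul]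
      conv_lhs =>
        enter [1]
        rw [hγκ x, add_mul]
        enter [2, 1]
        rw [hqq' x]
      ring
    simp only [h1]
    rw [norm_mul, norm_pow, Complex.norm_real, Real.norm_eq_abs, sq_abs]
    have h2 : ‖γ (erase e x) * (q' x - q' (erase e x) - (x e : ℂ) • q₁ (erase e x))‖ ≤
        ‖γ (erase e x)‖ * (K * x e ^ 2) := by
      rw [norm_mul]; exact mul_le_mul_of_nonneg_left (rq₁ x) (norm_nonneg _)
    have h3 : ‖(c : ℂ) * (κ x * q x - κ (erase e x) * q (erase e x) -
        (x e : ℂ) • s₁ (erase e x))‖ ≤ c * (3 * K * K * x e ^ 2) := by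
      rw [norm_mul, Complex.norm_real, Real.norm_of_nonneg hc]
      exact mul_le_mul_of_nonneg_left (rs₁ x) hc
    have h4 := mul_le_mul_of_nonneg_left ((norm_add_le _ _).trans (add_le_add h2 h3))
      (sq_nonneg (x e))
    refine h4.trans ?_
    have h5 : 0 ≤ x e ^ 4 * (K ^ 2 * c) := by positivity
    nlinarith
  · have h1 : γ x * u x + c * (θ x * q x) - (γ (erase e x) * u (erase e x) +
          c * (θ (erase e x) * q (erase e x)) + (x e : ℂ) ^ 1 * (γ (erase e x) * u₁ (erase e x) +
            (c * (κ (erase e x) * u (erase e x)) + c * t₁ (erase e x)))) =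
        γ (erase e x) * (u x - u (erase e x) - (x e : ℂ) • u₁ (erase e x)) +
          (x e : ℂ) * (c * (κ x * u x - κ (erase e x) * u (erase e x))) +
          c * (θ x * q x - θ (erase e x) * q (erase e x) - (x e : ℂ) • t₁ (erase e x)) := by
      rw [smul_eq_mul, smul_eq_mul]
      conv_lhs =>
        enter [1]
        rw [hγκ x]
      ring
    simp only [h1]
    have h2 : ‖γ (erase e x) * (u x - u (erase e x) - (x e : ℂ) • u₁ (erase e x))‖ ≤
        ‖γ (erase e x)‖ * (K * x e ^ 2) := by
      rw [norm_mul]; exact mul_le_mul_of_nonneg_left (ru₁ x) (norm_nonneg _)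
    have h3 : ‖(c : ℂ) * (θ x * q x - θ (erase e x) * q (erase e x) -
        (x e : ℂ) • t₁ (erase e x))‖ ≤ c * (3 * K * K * x e ^ 2) := by
      rw [norm_mul, Complex.norm_real, Real.norm_of_nonneg hc]
      exact mul_le_mul_of_nonneg_left (rt₁ x) hc
    have h4 : ‖(x e : ℂ) * (c * (κ x * u x - κ (erase e x) * u (erase e x)))‖ ≤
        |x e| * (c * (3 * K * K * |x e|)) := by
      rw [norm_mul, norm_mul, Complex.norm_real, Complex.norm_real, Real.norm_eq_abs,
        Real.norm_of_nonneg hc]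
      exact mul_le_mul_of_nonneg_left (mul_le_mul_of_nonneg_left (hκu.2.2.1 x) hc) (abs_nonneg _)
    refine ((norm_add_le _ _).trans (add_le_add ((norm_add_le _ _).trans
      (add_le_add h2 h4)) h3)).trans (le_of_eq ?_)
    rw [← sq_abs (x e)]
    ring

end CumulantExpansion

theorem integral_norm_mul_norm_le {α : Type*} [MeasurableSpace α] {μ : Measure α}
    [IsFiniteMeasure μ] {f g : α → ℂ} (hf : BoundedMeasurable f) (hg : BoundedMeasurable g) :
    ∫ x, ‖f x‖ * ‖g x‖ ∂μ ≤
      Real.sqrt (∫ x, ‖f x‖ ^ 2 ∂μ) * Real.sqrt (∫ x, ‖g x‖ ^ 2 ∂μ) := by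
  have hLp : ∀ {h : α → ℂ}, BoundedMeasurable h → MemLp h (ENNReal.ofReal 2) μ := fun hh =>
    let ⟨C, hC⟩ := hh.2
    MemLp.of_bound hh.1.aestronglyMeasurable C (Filter.Eventually.of_forall hC)
  have h := integral_mul_norm_le_Lp_mul_Lq (μ := μ) Real.HolderConjugate.two_two (hLp hf) (hLp hg)
  simpa [Real.sqrt_eq_rpow] using h

/-! ### Covariance of the normalized trace with a diagonal resolvent entry -/

section BandExpansion

variable {n : ℕ} {z : ℂ}

theorem sum_pairs_edge (i s : Site n) (f : Site n × Site n → ℂ) :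
    ∑ p ∈ pairs (edge i s), f p = f (s, i) + if i = s then 0 else f (i, s) := by
  have h : pairs (edge i s) = {(s, i), (i, s)} := by
    ext ⟨a, b⟩
    rw [mem_pairs]
    simp only [edge, Finset.mem_insert, Finset.mem_singleton, Prod.mk.injEq, Subtype.mk.injEq]
    constructor
    · rintro ⟨h1, h2⟩
      rcases le_total a b with h | h <;> rcases le_total i s with h' | h' <;>
        simp_all
    · rintro (⟨rfl, rfl⟩ | ⟨rfl, rfl⟩)
      · exact ⟨min_comm _ _, max_comm _ _⟩
      · exact ⟨rfl, rfl⟩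
  rw [h]
  by_cases his : i = s
  · subst his; simp
  · rw [if_neg his, Finset.sum_pair]
    simp [Ne.symm his]

/-- The normalized trace of the resolvent as a function of the matrix entries. -/
noncomputable def meanTrace (z : ℂ) (x : Edge n → ℝ) : ℂ :=
  (2 * (n : ℂ) + 1)⁻¹ * ∑ i, green z x i i

/-- The resolvent identity and cyclicity of the trace. The difference quotient stays bounded as the
dimension grows, so after division by `N` the normalized trace varies slowly in each entry. -/
theorem trace_green_sub (hz : 0 < |z.im|) (x : Edge n → ℝ) (e : Edge n) :
    ∑ i, green z x i i = ∑ i, green z (erase e x) i i +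
      (x e : ℂ) * -∑ p ∈ pairs e, (green z x * green z (erase e x)) p.2 p.1 := by
  have h : (green z x).trace = (green z (erase e x)).trace -
      (x e : ℂ) * (bump e * (green z x * green z (erase e x))).trace := by
    conv_lhs => rw [green_sub hz x e]
    rw [Matrix.trace_sub, Matrix.trace_smul, smul_eq_mul, mul_assoc, Matrix.trace_mul_comm,
      mul_assoc]
  rw [trace_bump_mul] at h
  simp only [Matrix.trace, Matrix.diag_apply] at h
  rw [h]; ring

theorem boundedMeasurable_green (hz : 1 ≤ |z.im|) (i j : Site n) :
    BoundedMeasurable fun x => green z x i j :=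
  ⟨(continuous_green_apply (by linarith) i j).measurable, 1, fun x =>
    (norm_entry_le _ i j).trans (norm_green_le_one hz x)⟩

theorem boundedMeasurable_meanTrace (hz : 1 ≤ |z.im|) :
    BoundedMeasurable (meanTrace (n := n) z) :=
  (BoundedMeasurable.const _).mul (.sum _ fun i _ => boundedMeasurable_green hz i i)

variable (ρ : Edge n → Measure ℝ) [∀ e, IsProbabilityMeasure (ρ e)]

/-- Integration by parts for a resolvent entry against the centred normalized trace. -/
theorem norm_integral_coord_mul_green_sub_le (hz : 1 ≤ |z.im|) {e : Edge n} {w m₄ m₆ : ℝ}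
    (hρ : MomentData (ρ e) w m₄ m₆) (hw : w ≤ 1) (i s : Site n) (m : ℂ) :
    ‖∫ x, (x e : ℂ) * ((meanTrace z x - m) * green z x s i) ∂(Measure.pi ρ) -
      (w : ℂ) * ∫ x, ((meanTrace z x - m) * -(green z x * bump e * green z x) s i +
        ((2 * (n : ℝ) + 1)⁻¹ : ℝ) * (-(∑ p ∈ pairs e, (green z x * green z x) p.2 p.1) *
          green z x s i)) ∂(Measure.pi ρ)‖ ≤
      2 * m₄ * (288 * ∫ x, ‖meanTrace z x - m‖ ∂(Measure.pi ρ) +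
        7 * 288 ^ 2 * (2 * (n : ℝ) + 1)⁻¹) := by
  have hz0 : 0 < |z.im| := by linarith
  have hG := hasJet_green (n := n) hz e
  have hP : HasJet e 1 (fun x => green z (erase e x)) :=
    .of_erase ((continuous_green hz0).comp (continuous_erase e))
      (fun x => norm_green_le_one hz _) (by simp)
  have hΔ : HasJet e 2 (fun _ : Edge n → ℝ => bump e) :=
    .of_erase continuous_const (fun _ => norm_bump_le e) (by simp)
  have hPΔ : HasJet e 2 (fun x => green z (erase e x) * bump e) :=
    .of_erase (((continuous_green hz0).comp (continuous_erase e)).mul continuous_const)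
      (fun x => (norm_mul_le _ _).trans (by
        have h1 := norm_green_le_one hz (erase e x)
        have h2 := norm_bump_le e
        nlinarith [norm_nonneg (bump e)])) (by simp)
  have hq' : HasJet e 24 (fun x => -(green z (erase e x) * bump e * green z x) s i) :=
    ((hPΔ.mul hG).entry s i).neg.mono (by norm_num)
  have hκ : HasJet e 24 (fun x =>
      -∑ p ∈ pairs e, (green z x * green z (erase e x)) p.2 p.1) :=
    (HasJet.sum_pairs (Y := fun p x => (green z x * green z (erase e x)) p.2 p.1)
      (fun p _ => (hG.mul hP).entry p.2 p.1) (by norm_num)).neg.mono (by norm_num)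
  -- `288 = 3 * (3 * 4 * 2) * 4`, the product rule applied twice, is the largest jet constant that
  -- occurs and serves as the common `K`.
  have hu : HasJet e 288 (fun x => -(green z x * bump e * green z x) s i) :=
    (((hG.mul hΔ).mul hG).entry s i).neg.mono (by norm_num)
  have hθ : HasJet e 96 (fun x => -∑ p ∈ pairs e, (green z x * green z x) p.2 p.1) :=
    (HasJet.sum_pairs (Y := fun p x => (green z x * green z x) p.2 p.1)
      (fun p _ => (hG.mul hG).entry p.2 p.1) (by norm_num)).neg.mono (by norm_num)
  refine norm_integral_coord_mul_sub_le ρ hρ hw (q := fun x => green z x s i)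
    (γ := fun x => meanTrace z x - m)
    (q' := fun x => -(green z (erase e x) * bump e * green z x) s i)
    (κ := fun x => -∑ p ∈ pairs e, (green z x * green z (erase e x)) p.2 p.1)
    (u := fun x => -(green z x * bump e * green z x) s i)
    (θ := fun x => -∑ p ∈ pairs e, (green z x * green z x) p.2 p.1)
    (c := (2 * (n : ℝ) + 1)⁻¹) (by positivity)
    ((boundedMeasurable_meanTrace hz).sub (.const m)) ((hG.entry s i).mono (by norm_num))
    (hq'.mono (by norm_num)) (hκ.mono (by norm_num)) hu (hθ.mono (by norm_num))
    (fun x => ?_) (fun x => ?_) (fun x => by simp) (fun x => by simp)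
  · conv_lhs => rw [green_sub hz0 x e]
    rw [Matrix.sub_apply, Matrix.smul_apply, smul_eq_mul]
    ring
  · simp only [meanTrace]
    rw [trace_green_sub hz0 x e]
    push_cast
    ring

/-- This diagonal entry of `(H - z) G = 1` is where the covariance estimate starts: it exhibits
explicit entries by which one can integrate by parts. -/
theorem sum_coord_mul_green (hz : 0 < |z.im|) (x : Edge n → ℝ) (i : Site n) :
    ∑ s, (x (edge i s) : ℂ) * green z x s i = 1 + z * green z x i i := by
  have h : (symMatrix x - z • (1 : Matrix (Site n) (Site n) ℂ)) * green z x = 1 :=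
    Matrix.mul_nonsing_inv _ (isUnit_det hz x)
  have h2 := congrFun (congrFun h i) i
  rw [sub_mul, smul_mul_assoc, one_mul, Matrix.sub_apply, Matrix.smul_apply, smul_eq_mul,
    Matrix.one_apply_eq, Matrix.mul_apply] at h2
  rw [← h2]
  simp [symMatrix]

theorem sum_norm_mul_norm_le {A B : Site n → ℂ} (hA : ∑ s, ‖A s‖ ^ 2 ≤ 1)
    (hB : ∑ s, ‖B s‖ ^ 2 ≤ 1) : ∑ s, ‖A s‖ * ‖B s‖ ≤ 1 := by
  have h : ∀ s, ‖A s‖ * ‖B s‖ ≤ (‖A s‖ ^ 2 + ‖B s‖ ^ 2) / 2 := fun s => by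
    nlinarith [sq_nonneg (‖A s‖ - ‖B s‖)]
  refine (Finset.sum_le_sum fun s _ => h s).trans ?_
  rw [← Finset.sum_div, Finset.sum_add_distrib]
  linarith

/-- The leading terms of the expansion differ from a product of diagonal entries by a small
quantity. -/
theorem norm_sum_leading_add_le (hz : 1 ≤ |z.im|) (x : Edge n → ℝ) (i : Site n) {w : Site n → ℝ}
    {W : ℝ} (hw0 : ∀ s, 0 ≤ w s) (hwW : ∀ s, w s ≤ W) {c : ℝ} (hc : 0 ≤ c) (γ : ℂ) :
    ‖∑ s, (w s : ℂ) * (γ * -(green z x * bump (edge i s) * green z x) s i +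
        (c : ℂ) * (-(∑ p ∈ pairs (edge i s), (green z x * green z x) p.2 p.1) * green z x s i)) +
      γ * (green z x i i * ∑ s, (w s : ℂ) * green z x s s)‖ ≤ W * (‖γ‖ + 2 * c) := by
  set G := green z x with hGdef
  have hG : ‖G‖ ≤ 1 := norm_green_le_one hz x
  have hG2 : ‖G * G‖ ≤ 1 := (norm_mul_le _ _).trans (by nlinarith [norm_nonneg G])
  have hrow : ∀ {A : Matrix (Site n) (Site n) ℂ}, ‖A‖ ≤ 1 → ∑ s, ‖A i s‖ ^ 2 ≤ 1 := fun hA =>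
    (sum_norm_row_sq_le _ i).trans (pow_le_one₀ (norm_nonneg _) hA)
  have hcol : ∀ {A : Matrix (Site n) (Site n) ℂ}, ‖A‖ ≤ 1 → ∑ s, ‖A s i‖ ^ 2 ≤ 1 := fun hA =>
    (sum_norm_col_sq_le _ i).trans (pow_le_one₀ (norm_nonneg _) hA)
  -- Of the two orientations in `(G * bump * G) s i`, one yields `G s s * G i i` and cancels the
  -- added product. The other terms are products along row or column `i`, which Cauchy–Schwarz sums
  -- to a bounded quantity.
  have e1 : ∑ s, (w s : ℂ) * (γ * -(G * bump (edge i s) * G) s i +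
        (c : ℂ) * (-(∑ p ∈ pairs (edge i s), (G * G) p.2 p.1) * G s i)) +
      γ * (G i i * ∑ s, (w s : ℂ) * G s s) =
      ∑ s, (w s : ℂ) * (-γ * (if i = s then 0 else G s i * G s i) -
        c * (((G * G) i s + if i = s then 0 else (G * G) s i) * G s i)) := by
    rw [Finset.mul_sum, Finset.mul_sum, ← Finset.sum_add_distrib]
    refine Finset.sum_congr rfl fun s _ => ?_
    rw [mul_bump_mul_apply, sum_pairs_edge, sum_pairs_edge]
    simp only
    ring
  rw [e1]
  have h1 : ∀ s, ‖(w s : ℂ) * (-γ * (if i = s then 0 else G s i * G s i) -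
        c * (((G * G) i s + if i = s then 0 else (G * G) s i) * G s i))‖ ≤
      W * (‖γ‖ * ‖G s i‖ ^ 2 + c * (‖(G * G) i s‖ * ‖G s i‖ + ‖(G * G) s i‖ * ‖G s i‖)) := by
    intro s
    rw [norm_mul, Complex.norm_real, Real.norm_of_nonneg (hw0 s)]
    refine mul_le_mul (hwW s) ?_ (norm_nonneg _) ((hw0 s).trans (hwW s))
    refine (norm_sub_le _ _).trans (add_le_add ?_ ?_)
    · rw [norm_mul, norm_neg]
      refine mul_le_mul_of_nonneg_left ?_ (norm_nonneg _)
      split_ifs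
      · simp
      · rw [norm_mul, sq]
    · rw [norm_mul, Complex.norm_real, Real.norm_of_nonneg hc, norm_mul, ← add_mul]
      refine mul_le_mul_of_nonneg_left (mul_le_mul_of_nonneg_right ?_ (norm_nonneg _)) hc
      refine (norm_add_le _ _).trans (add_le_add le_rfl ?_)
      split_ifs
      · simp
      · exact le_rfl
  refine (norm_sum_le_of_le _ fun s _ => h1 s).trans ?_
  have hW : 0 ≤ W := (hw0 i).trans (hwW i)
  rw [← Finset.mul_sum]
  refine mul_le_mul_of_nonneg_left ?_ hW
  rw [Finset.sum_add_distrib, ← Finset.mul_sum, ← Finset.mul_sum, Finset.sum_add_distrib]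
  have h2 := mul_le_mul_of_nonneg_left (hcol hG) (norm_nonneg γ)
  have h3 := sum_norm_mul_norm_le (hrow hG2) (hcol hG)
  have h4 := sum_norm_mul_norm_le (hcol hG2) (hcol hG)
  have h5 := mul_le_mul_of_nonneg_left (add_le_add h3 h4) hc
  linarith

/-- The variance of the normalized trace. -/
theorem variance_meanTrace_le (hz : 1 ≤ |z.im|) {b v : ℝ} {p : Edge n → ℝ} (hb : 1 ≤ b)
    (hbv : 8 * v ^ 2 ≤ b) (hp0 : ∀ e, 0 ≤ p e) (hp1 : ∀ e, p e ≤ 1)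
    (hp : ∀ i, ∑ j, p (edge i j) ≤ b + 1)
    (hρ : ∀ e, MomentData (ρ e) (v ^ 2 * p e / b) (3 * v ^ 4 * p e / b ^ 2)
      (15 * v ^ 6 * p e / b ^ 3)) :
    ∫ x, ‖meanTrace z x - ∫ u, meanTrace z u ∂(Measure.pi ρ)‖ ^ 2 ∂(Measure.pi ρ) ≤
      (8 * v ^ 2 + 120000 * (3 * v ^ 4 + 15 * v ^ 6)) / b * (2 * (n : ℝ) + 1)⁻¹ := by
  -- Here `∑ D s = N`, and the normalization contributes `N⁻¹` squared, so one factor `N⁻¹` remains.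
  have h := variance_weightedTrace_le ρ (D := fun _ => 1) hz (fun _ => zero_le_one)
    (fun _ => le_rfl) hb hbv hp0 hp1 hp hρ
  have hcard : (Fintype.card (Site n) : ℝ) = 2 * n + 1 := by
    rw [Fintype.card_coe, Int.card_Icc]
    have : ((n : ℤ) + 1 - -(n : ℤ)).toNat = 2 * n + 1 := by omega
    rw [this]; push_cast; ring
  have h1 : ∀ x : Edge n → ℝ, meanTrace z x =
      (((2 * (n : ℝ) + 1)⁻¹ : ℝ) : ℂ) * weightedTrace z (fun _ => 1) x := by
    intro x; simp [meanTrace, weightedTrace]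
  have hN : 0 < 2 * (n : ℝ) + 1 := by positivity
  simp_rw [h1, integral_const_mul, ← mul_sub, norm_mul, mul_pow, integral_const_mul,
    Complex.norm_real, Real.norm_of_nonneg (inv_nonneg.2 hN.le)]
  simp only [Finset.sum_const, Finset.card_univ, nsmul_eq_mul, mul_one, hcard] at h
  have h2 := mul_le_mul_of_nonneg_left h (sq_nonneg (2 * (n : ℝ) + 1)⁻¹)
  refine h2.trans (le_of_eq ?_)
  field_simp

/-- The covariance of the normalized trace and a diagonal entry of the resolvent. -/
theorem norm_integral_meanTrace_mul_green_le {b v : ℝ} (hv : 0 ≤ v)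
    (hz : 2 * v + 1 ≤ |z.im|) {p : Edge n → ℝ} (hb : 1 ≤ b)
    (hbv : 8 * v ^ 2 ≤ b) (hp0 : ∀ e, 0 ≤ p e) (hp1 : ∀ e, p e ≤ 1)
    (hp : ∀ i, ∑ j, p (edge i j) ≤ b + 1)
    (hρ : ∀ e, MomentData (ρ e) (v ^ 2 * p e / b) (3 * v ^ 4 * p e / b ^ 2)
      (15 * v ^ 6 * p e / b ^ 3)) (i : Site n) {V : ℝ}
    (hV : ∫ x, ‖meanTrace z x - ∫ u, meanTrace z u ∂(Measure.pi ρ)‖ ^ 2 ∂(Measure.pi ρ) = V) :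
    ‖∫ x, (meanTrace z x - ∫ u, meanTrace z u ∂(Measure.pi ρ)) * green z x i i ∂(Measure.pi ρ)‖ ≤
      2 * (2 * v ^ 2 + 12 * v ^ 4 * (7 * 288 ^ 2) +
        v ^ 2 * Real.sqrt (2 * (8 * v ^ 2 + 120000 * (3 * v ^ 4 + 15 * v ^ 6)))) / b *
        (Real.sqrt V + (2 * (n : ℝ) + 1)⁻¹) := by
  have hz1 : 1 ≤ |z.im| := by linarith
  have hz0 : 0 < |z.im| := by linarith
  have hb0 : 0 < b := by linarith
  set ν := Measure.pi ρ with hν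
  set A := 8 * v ^ 2 + 120000 * (3 * v ^ 4 + 15 * v ^ 6) with hA
  set m := ∫ u, meanTrace z u ∂ν with hm
  set c : ℝ := (2 * (n : ℝ) + 1)⁻¹ with hc
  have hc0 : 0 ≤ c := by positivity
  -- The weights of the local average seen from site `i`; their total is of order `b`, so its
  -- variance stays bounded.
  set D : Site n → ℝ := fun s => p (edge i s) with hD
  have hγ : BoundedMeasurable (fun x : Edge n → ℝ => meanTrace z x - m) :=
    (boundedMeasurable_meanTrace hz1).sub (.const m)
  have hγ0 : ∫ x, (meanTrace z x - m) ∂ν = 0 := by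
    rw [integral_sub (boundedMeasurable_meanTrace hz1).integrable (integrable_const _)]
    simp [hm]
  have hGi := boundedMeasurable_green (n := n) hz1 i i
  have hF : BoundedMeasurable (weightedTrace z D) :=
    boundedMeasurable_weightedTrace hz1 fun s => hp0 _
  set f := ∫ x, weightedTrace z D x ∂ν with hf
  set Y := ∫ x, (meanTrace z x - m) * green z x i i ∂ν with hY
  have hE : ∫ x, ‖meanTrace z x - m‖ ∂ν ≤ Real.sqrt V := by
    have := integral_norm_mul_norm_le (μ := ν) hγ (.const 1)
    simpa [hV] using this
  set E := ∫ x, ‖meanTrace z x - m‖ ∂ν with hEdef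
  have hE0 : 0 ≤ E := integral_nonneg fun x => norm_nonneg _
  set lead : Site n → (Edge n → ℝ) → ℂ := fun s x =>
    (meanTrace z x - m) * -(green z x * bump (edge i s) * green z x) s i +
      (c : ℂ) * (-(∑ p ∈ pairs (edge i s), (green z x * green z x) p.2 p.1) * green z x s i)
    with hlead
  have hleadB : ∀ s, BoundedMeasurable (lead s) := by
    intro s
    have h1 : BoundedMeasurable fun x : Edge n → ℝ => -(green z x * bump (edge i s) * green z x) s i :=
      ((((hasJet_green hz1 (edge i s)).mul (.of_erase continuous_const
        (fun _ => norm_bump_le (edge i s)) (by simp))).mul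
          (hasJet_green hz1 (edge i s))).entry s i).neg.boundedMeasurable
    have h2 : BoundedMeasurable fun x : Edge n → ℝ =>
        -(∑ p ∈ pairs (edge i s), (green z x * green z x) p.2 p.1) :=
      (HasJet.sum_pairs (Y := fun p x => (green z x * green z x) p.2 p.1)
        (fun p _ => ((hasJet_green hz1 (edge i s)).mul
          (hasJet_green hz1 (edge i s))).entry p.2 p.1) (by norm_num)).neg.boundedMeasurable
    exact (hγ.mul h1).add ((BoundedMeasurable.const _).mul
      (h2.mul (boundedMeasurable_green hz1 s i)))
  set w : Site n → ℝ := fun s => v ^ 2 * p (edge i s) / b with hw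
  have hw0 : ∀ s, 0 ≤ w s := fun s => by have := hp0 (edge i s); positivity
  have hwW : ∀ s, w s ≤ v ^ 2 / b := fun s => by
    have := hp1 (edge i s)
    simp only [hw]
    gcongr
    exact mul_le_of_le_one_right (by positivity) this
  have hv8 : v ^ 2 / b ≤ 1 / 8 := by rw [div_le_iff₀ hb0]; linarith
  -- the resolvent identity
  have s1 : ∑ s, ∫ x, (x (edge i s) : ℂ) * ((meanTrace z x - m) * green z x s i) ∂ν = z * Y := by
    rw [← integral_finsetSum _ fun s _ => integrable_coord_mul ρ (hρ _)
      (hγ.mul (boundedMeasurable_green hz1 s i))]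
    have h1 : ∀ x : Edge n → ℝ, ∑ s, (x (edge i s) : ℂ) * ((meanTrace z x - m) * green z x s i) =
        (meanTrace z x - m) + z * ((meanTrace z x - m) * green z x i i) := by
      intro x
      have := sum_coord_mul_green hz0 x i
      calc _ = (meanTrace z x - m) * ∑ s, (x (edge i s) : ℂ) * green z x s i := by
            rw [Finset.mul_sum]; exact Finset.sum_congr rfl fun s _ => by ring
        _ = _ := by rw [this]; ring
    simp_rw [h1]
    rw [integral_add hγ.integrable ((hγ.mul hGi).integrable.const_mul z), hγ0,
      integral_const_mul, zero_add]
  -- integration by parts in every entry of the row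
  have s2 : ‖z * Y - ∑ s, (w s : ℂ) * ∫ x, lead s x ∂ν‖ ≤
      12 * v ^ 4 / b * (288 * E + 7 * 288 ^ 2 * c) := by
    rw [← s1, ← Finset.sum_sub_distrib]
    have h1 : ∀ s, ‖∫ x, (x (edge i s) : ℂ) * ((meanTrace z x - m) * green z x s i) ∂ν -
        (w s : ℂ) * ∫ x, lead s x ∂ν‖ ≤
        6 * v ^ 4 / b ^ 2 * (288 * E + 7 * 288 ^ 2 * c) * p (edge i s) := by
      intro s
      have := norm_integral_coord_mul_green_sub_le ρ hz1 (hρ (edge i s))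
        ((hwW s).trans (by linarith)) i s m
      refine this.trans (le_of_eq ?_)
      ring
    refine (norm_sum_le_of_le _ fun s _ => h1 s).trans ?_
    rw [← Finset.mul_sum]
    -- Each entry has fourth moment proportional to `p / b ^ 2`; the row sum recovers one factor
    -- `b`.
    have h2 : ∑ s, p (edge i s) ≤ 2 * b := (hp i).trans (by linarith)
    refine (mul_le_mul_of_nonneg_left h2 (by positivity)).trans (le_of_eq ?_)
    field_simp
    ring
  have s3 : ‖∑ s, (w s : ℂ) * ∫ x, lead s x ∂ν +
      (v ^ 2 / b : ℝ) * ∫ x, (meanTrace z x - m) * (green z x i i * weightedTrace z D x) ∂ν‖ ≤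
      v ^ 2 / b * (E + 2 * c) := by
    simp only [← integral_const_mul]
    rw [← integral_finsetSum _ fun s _ => (hleadB s).integrable.const_mul _, ← integral_add
      (integrable_finsetSum _ fun s _ => (hleadB s).integrable.const_mul _)
      ((hγ.mul (hGi.mul hF)).integrable.const_mul _)]
    have h1 : Integrable (fun x : Edge n → ℝ => v ^ 2 / b * (‖meanTrace z x - m‖ + 2 * c)) ν :=
      (hγ.integrable.norm.add (integrable_const _)).const_mul _
    have h2 : ∫ x, v ^ 2 / b * (‖meanTrace z x - m‖ + 2 * c) ∂ν = v ^ 2 / b * (E + 2 * c) := by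
      rw [integral_const_mul, integral_add hγ.integrable.norm (integrable_const _)]
      simp [hEdef]
    rw [← h2]
    refine norm_integral_le_of_norm_le h1 (Filter.Eventually.of_forall fun x => ?_)
    have h3 := norm_sum_leading_add_le hz1 x i hw0 hwW hc0 (meanTrace z x - m)
    have h4 : ((v ^ 2 / b : ℝ) : ℂ) * ((meanTrace z x - m) *
        (green z x i i * weightedTrace z D x)) =
        (meanTrace z x - m) * (green z x i i * ∑ s, (w s : ℂ) * green z x s s) := by
      have : ∑ s, (w s : ℂ) * green z x s s = ((v ^ 2 / b : ℝ) : ℂ) * weightedTrace z D x := by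
        rw [weightedTrace, Finset.mul_sum]
        refine Finset.sum_congr rfl fun s _ => ?_
        simp only [hw, hD]
        push_cast
        ring
      rw [this]; ring
    rw [h4]
    exact h3
  -- decoupling of the local average
  have s4 : ∫ x, (meanTrace z x - m) * (green z x i i * weightedTrace z D x) ∂ν =
      ∫ x, ((meanTrace z x - m) * green z x i i) * (weightedTrace z D x - f) ∂ν + f * Y := by
    rw [hY, ← integral_const_mul, ← integral_add
      ((hγ.mul hGi).mul (hF.sub (.const f))).integrable ((hγ.mul hGi).integrable.const_mul f)]
    congr 1
    ext x
    ring
  have hSD : ∑ s, D s ≤ 2 * b := (hp i).trans (by linarith)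
  -- Cauchy–Schwarz after bounding `G i i` by one: the local average has variance at most `A / b *
  -- (2 * b) = 2 * A`.
  have s5 : ‖∫ x, ((meanTrace z x - m) * green z x i i) * (weightedTrace z D x - f) ∂ν‖ ≤
      Real.sqrt V * Real.sqrt (2 * A) := by
    have h1 := integral_norm_mul_norm_le (μ := ν) hγ (hF.sub (.const f))
    have h2 := variance_weightedTrace_le ρ (D := D) hz1 (fun s => hp0 _) (fun s => hp1 _) hb hbv
      hp0 hp1 hp hρ
    have h3 : A / b * ∑ s, D s ≤ 2 * A := by
      have hA0 : 0 ≤ A := by positivity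
      refine (mul_le_mul_of_nonneg_left hSD (by positivity)).trans (le_of_eq ?_)
      field_simp
    rw [hV] at h1
    refine (norm_integral_le_of_norm_le (by simpa only [norm_mul] using (hγ.mul (hF.sub (.const f))).integrable.norm)
      (Filter.Eventually.of_forall fun x => ?_)).trans (h1.trans ?_)
    · rw [norm_mul, norm_mul]
      exact mul_le_mul_of_nonneg_right (mul_le_of_le_one_right (norm_nonneg _)
        ((norm_entry_le _ i i).trans (norm_green_le_one hz1 x))) (norm_nonneg _)
    · exact mul_le_mul_of_nonneg_left (Real.sqrt_le_sqrt (h2.trans h3)) (Real.sqrt_nonneg _)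
  -- Here the size of the imaginary part matters: `‖G‖ ≤ 1 / |Im z|` gives `2 v² / |Im z|`, which is
  -- at most `|Im z| / 2` because `|Im z| ≥ 2 v`. Half of `|Im z| * ‖Y‖` therefore survives the
  -- absorption.
  have s6 : v ^ 2 / b * ‖f‖ ≤ |z.im| / 2 := by
    have h1 : ‖f‖ ≤ 2 * b * |z.im|⁻¹ := by
      have h2 : ∀ x, ‖weightedTrace z D x‖ ≤ 2 * b * |z.im|⁻¹ := by
        intro x
        have h3 : ∀ s, ‖(D s : ℂ) * green z x s s‖ ≤ D s * |z.im|⁻¹ := by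
          intro s
          rw [norm_mul, Complex.norm_real, Real.norm_of_nonneg (hp0 _)]
          exact mul_le_mul_of_nonneg_left ((norm_entry_le _ s s).trans (norm_green_le hz0 x))
            (hp0 _)
        refine (norm_sum_le_of_le _ fun s _ => h3 s).trans ?_
        rw [← Finset.sum_mul]
        exact mul_le_mul_of_nonneg_right hSD (by positivity)
      have := norm_integral_le_of_norm_le_const (μ := ν) (Filter.Eventually.of_forall h2)
      simpa using this
    refine (mul_le_mul_of_nonneg_left h1 (by positivity)).trans ?_
    have h4 : v ^ 2 / b * (2 * b * |z.im|⁻¹) = 2 * v ^ 2 / |z.im| := by field_simp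
    rw [h4, div_le_iff₀ hz0]
    nlinarith
  -- conclusion
  set R := ∫ x, ((meanTrace z x - m) * green z x i i) * (weightedTrace z D x - f) ∂ν with hR
  set L := ∑ s, (w s : ℂ) * ∫ x, lead s x ∂ν with hL
  rw [s4] at s3
  have t1 : z * Y = (z * Y - L) + (L + (v ^ 2 / b : ℝ) * (R + f * Y)) -
      (v ^ 2 / b : ℝ) * R - (v ^ 2 / b : ℝ) * f * Y := by ring
  have hvb : 0 ≤ v ^ 2 / b := by positivity
  have t2 : ‖((v ^ 2 / b : ℝ) : ℂ) * R‖ ≤ v ^ 2 / b * (Real.sqrt V * Real.sqrt (2 * A)) := by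
    rw [norm_mul, Complex.norm_real, Real.norm_of_nonneg hvb]
    exact mul_le_mul_of_nonneg_left s5 hvb
  have t3 : ‖((v ^ 2 / b : ℝ) : ℂ) * f * Y‖ ≤ |z.im| / 2 * ‖Y‖ := by
    rw [norm_mul, norm_mul, Complex.norm_real, Real.norm_of_nonneg hvb]
    exact mul_le_mul_of_nonneg_right s6 (norm_nonneg _)
  have t4 : |z.im| * ‖Y‖ ≤ ‖z * Y‖ := by
    rw [norm_mul]
    exact mul_le_mul_of_nonneg_right (Complex.abs_im_le_norm z) (norm_nonneg _)
  have t5 : ‖z * Y‖ ≤ 12 * v ^ 4 / b * (288 * E + 7 * 288 ^ 2 * c) + v ^ 2 / b * (E + 2 * c) +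
      v ^ 2 / b * (Real.sqrt V * Real.sqrt (2 * A)) + |z.im| / 2 * ‖Y‖ := by
    rw [t1]
    refine (norm_sub_le _ _).trans (add_le_add ((norm_sub_le _ _).trans (add_le_add
      ((norm_add_le _ _).trans (add_le_add s2 s3)) t2)) t3)
  have t6 : ‖Y‖ ≤ |z.im| * ‖Y‖ := le_mul_of_one_le_left (norm_nonneg _) hz1
  have hsV := Real.sqrt_nonneg V
  have hsA := Real.sqrt_nonneg (2 * A)
  have t7 : 12 * v ^ 4 / b * (288 * E + 7 * 288 ^ 2 * c) ≤
      12 * v ^ 4 / b * (7 * 288 ^ 2 * (Real.sqrt V + c)) :=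
    mul_le_mul_of_nonneg_left (by linarith) (by positivity)
  have t8 : v ^ 2 / b * (E + 2 * c) ≤ v ^ 2 / b * (2 * (Real.sqrt V + c)) :=
    mul_le_mul_of_nonneg_left (by linarith) hvb
  have t9 : v ^ 2 / b * (Real.sqrt V * Real.sqrt (2 * A)) ≤
      v ^ 2 / b * ((Real.sqrt V + c) * Real.sqrt (2 * A)) :=
    mul_le_mul_of_nonneg_left (mul_le_mul_of_nonneg_right (by linarith) hsA) hvb
  have t10 : ‖Y‖ ≤ 2 * (12 * v ^ 4 / b * (7 * 288 ^ 2 * (Real.sqrt V + c)) +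
      v ^ 2 / b * (2 * (Real.sqrt V + c)) +
      v ^ 2 / b * ((Real.sqrt V + c) * Real.sqrt (2 * A))) := by linarith
  refine t10.trans (le_of_eq ?_)
  ring

end BandExpansion

/-! ### Row sums of the connection probabilities -/

section Profile

variable {ψ : ℝ → ℝ}

theorem IsProfile.integrable (hψ : IsProfile ψ) : Integrable ψ := by
  by_contra h
  have := hψ.integral_eq_one
  rw [integral_undef h] at this
  exact zero_ne_one this

theorem IsProfile.intervalIntegral_le (hψ : IsProfile ψ) {R : ℝ} (hR : 0 ≤ R) :
    ∫ t in (0 : ℝ)..R, ψ t ≤ 1 / 2 := by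
  have h1 : ∫ t in (-R)..0, ψ t = ∫ t in (0 : ℝ)..R, ψ t := by
    have := intervalIntegral.integral_comp_neg (a := 0) (b := R) ψ
    simp only [hψ.even, neg_zero] at this
    exact this.symm
  have h2 : ∫ t in (-R)..R, ψ t = (∫ t in (-R)..0, ψ t) + ∫ t in (0 : ℝ)..R, ψ t :=
    (intervalIntegral.integral_add_adjacent_intervals
      (hψ.continuous.intervalIntegrable _ _) (hψ.continuous.intervalIntegrable _ _)).symm
  have h3 : ∫ t in (-R)..R, ψ t ≤ 1 := by
    rw [intervalIntegral.integral_of_le (by linarith), ← hψ.integral_eq_one]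
    exact setIntegral_le_integral hψ.integrable (Filter.Eventually.of_forall hψ.nonneg)
  linarith

/-- A right-endpoint Riemann sum of a decreasing function lies below its integral. Rescaling by `b`
and evenness, which gives half of the total mass to `[0, ∞)`, produce `b / 2`. -/
theorem IsProfile.sum_range_le (hψ : IsProfile ψ) {b : ℝ} (hb : 0 < b) (m : ℕ) :
    ∑ k ∈ Finset.range m, ψ (((k + 1 : ℕ) : ℝ) / b) ≤ b / 2 := by
  have hanti : AntitoneOn (fun t : ℝ => ψ (t / b)) (Set.Icc 0 (0 + m)) := by
    intro s hs t ht hst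
    exact hψ.antitoneOn (div_nonneg hs.1 hb.le) (div_nonneg ht.1 hb.le)
      (div_le_div_of_nonneg_right hst hb.le)
  have h1 := hanti.sum_le_integral
  simp only [zero_add] at h1
  refine h1.trans ?_
  rw [intervalIntegral.integral_comp_div (f := ψ) hb.ne', zero_div, smul_eq_mul]
  have := mul_le_mul_of_nonneg_left
    (hψ.intervalIntegral_le (R := (m : ℝ) / b) (by positivity)) hb.le
  linarith

theorem sum_Icc_even {f : ℤ → ℝ} (hf : ∀ k, f (-k) = f k) (m : ℕ) :
    ∑ k ∈ Finset.Icc (-(m : ℤ)) m, f k = f 0 + 2 * ∑ k ∈ Finset.range m, f ((k + 1 : ℕ) : ℤ) := by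
  induction m with
  | zero => simp
  | succ m ih =>
    have h : Finset.Icc (-((m + 1 : ℕ) : ℤ)) ((m + 1 : ℕ) : ℤ) =
        insert (-((m + 1 : ℕ) : ℤ)) (insert (((m + 1 : ℕ) : ℤ)) (Finset.Icc (-(m : ℤ)) m)) := by
      ext k
      simp only [Finset.mem_Icc, Finset.mem_insert]
      omega
    rw [h, Finset.sum_insert, Finset.sum_insert, ih, Finset.sum_range_succ, hf]
    · ring
    · simp
    · simp only [Finset.mem_insert, Finset.mem_Icc, not_or]
      omega

/-- The connection probability of an edge. -/
noncomputable def connProb {n : ℕ} (ψ : ℝ → ℝ) (b : ℝ) (e : Edge n) : ℝ :=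
  ψ (((e.1.1 : ℤ) - (e.1.2 : ℤ) : ℝ) / b)

theorem connProb_edge {n : ℕ} (hψ : IsProfile ψ) (b : ℝ) (i j : Site n) :
    connProb ψ b (edge i j) = ψ ((((i : ℤ) - (j : ℤ) : ℤ) : ℝ) / b) := by
  simp only [connProb, edge]
  rcases le_total i j with h | h
  · rw [min_eq_left h, max_eq_right h]; push_cast; rfl
  · rw [min_eq_right h, max_eq_left h, ← hψ.even]
    congr 1
    push_cast
    ring

/-- The differences `i - j` are distinct and lie in `[-2n, 2n]`. The zero difference contributes at
most `1` and each sign at most `b / 2`. -/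
theorem sum_connProb_le {n : ℕ} (hψ : IsProfile ψ) {b : ℝ} (hb : 0 < b) (i : Site n) :
    ∑ j, connProb ψ b (edge i j) ≤ b + 1 := by
  simp only [connProb_edge hψ]
  have h1 : ∑ j : Site n, ψ ((((i : ℤ) - (j : ℤ) : ℤ) : ℝ) / b) ≤
      ∑ k ∈ Finset.Icc (-((2 * n : ℕ) : ℤ)) ((2 * n : ℕ) : ℤ), ψ ((k : ℝ) / b) := by
    rw [← Finset.sum_image (s := Finset.univ) (g := fun j : Site n => (i : ℤ) - (j : ℤ))
      (f := fun k : ℤ => ψ ((k : ℝ) / b))]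
    · refine Finset.sum_le_sum_of_subset_of_nonneg ?_ fun _ _ _ => hψ.nonneg _
      intro k hk
      obtain ⟨j, -, rfl⟩ := Finset.mem_image.1 hk
      have h1 := Finset.mem_Icc.1 i.2
      have h2 := Finset.mem_Icc.1 j.2
      rw [Finset.mem_Icc]
      push_cast
      constructor <;> linarith [h1.1, h1.2, h2.1, h2.2]
    · intro j _ j' _ h
      exact Subtype.ext (by simpa using h)
  refine h1.trans ?_
  rw [sum_Icc_even (f := fun k : ℤ => ψ ((k : ℝ) / b))
    (fun k => by push_cast; rw [neg_div, hψ.even])]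
  have h2 := hψ.sum_range_le hb (2 * n)
  have h3 := hψ.le_one (((0 : ℤ) : ℝ) / b)
  simp only [Int.cast_natCast]
  linarith

end Profile

/-! ### The law of the matrix entries: independence and moments -/

section Law

variable {Ω : Type*} [MeasurableSpace Ω] {μ : Measure Ω}

/-- Induction on the finite set of indices: the two variables carried by a new index are independent
of all variables carried by the old ones, as these occupy disjoint parts of `ι ⊕ ι`. -/
theorem iIndepFun_comp_prod {ι : Type*} {a d : ι → Ω → ℝ}
    (ha : ∀ e, Measurable (a e)) (hd : ∀ e, Measurable (d e))
    (h : iIndepFun (Sum.elim a d) μ) {φ : ℝ × ℝ → ℝ} (hφ : Measurable φ) :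
    iIndepFun (fun e ω => φ (a e ω, d e ω)) μ := by
  classical
  have := h.isProbabilityMeasure
  have hm : ∀ i, Measurable (Sum.elim a d i) := by
    rintro (e | e)
    exacts [ha e, hd e]
  rw [iIndepFun_iff_measure_inter_preimage_eq_mul]
  intro S s hs
  induction S using Finset.induction_on with
  | empty => simp
  | insert e S he ih =>
    have hI := h.indepFun_finset {Sum.inl e, Sum.inr e} (S.disjSum S)
      (by
        rw [Finset.disjoint_left]
        rintro (f | f) hf hf' <;> simp_all) hm
    have hB1 : MeasurableSet {y : ↥({Sum.inl e, Sum.inr e} : Finset (ι ⊕ ι)) → ℝ |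
        φ (y ⟨Sum.inl e, by simp⟩, y ⟨Sum.inr e, by simp⟩) ∈ s e} :=
      (hφ.comp ((measurable_pi_apply _).prodMk (measurable_pi_apply _)))
        (hs e (Finset.mem_insert_self _ _))
    have hB2 : MeasurableSet (⋂ f : S, {y : ↥(S.disjSum S) → ℝ |
        φ (y ⟨Sum.inl f.1, Finset.inl_mem_disjSum.2 f.2⟩,
          y ⟨Sum.inr f.1, Finset.inr_mem_disjSum.2 f.2⟩) ∈ s f.1}) :=
      MeasurableSet.iInter fun f =>
        (hφ.comp ((measurable_pi_apply _).prodMk (measurable_pi_apply _)))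
          (hs f.1 (Finset.mem_insert_of_mem f.2))
    have hmul := hI.measure_inter_preimage_eq_mul _ _ hB1 hB2
    rw [Finset.prod_insert he, ← ih fun f hf => hs f (Finset.mem_insert_of_mem hf)]
    have hset : ⋂ i ∈ S, (fun ω => φ (a i ω, d i ω)) ⁻¹' s i =
        (fun ω (i : ↥(S.disjSum S)) => Sum.elim a d i ω) ⁻¹'
          (⋂ f : S, {y : ↥(S.disjSum S) → ℝ |
            φ (y ⟨Sum.inl f.1, Finset.inl_mem_disjSum.2 f.2⟩,
              y ⟨Sum.inr f.1, Finset.inr_mem_disjSum.2 f.2⟩) ∈ s f.1}) := by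
      ext ω
      simp
    rw [Finset.set_biInter_insert, hset]
    exact hmul

theorem ae_zero_or_one [IsProbabilityMeasure μ] {d : Ω → ℝ} (hd : Measurable d)
    {p : ℝ} (hp0 : 0 ≤ p) (hp1 : p ≤ 1) (h1 : μ {ω | d ω = 1} = ENNReal.ofReal p)
    (h0 : μ {ω | d ω = 0} = ENNReal.ofReal (1 - p)) : ∀ᵐ ω ∂μ, d ω = 1 ∨ d ω = 0 := by
  have m1 : MeasurableSet {ω | d ω = 1} := hd (measurableSet_singleton 1)
  have m0 : MeasurableSet {ω | d ω = 0} := hd (measurableSet_singleton 0)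
  have hdis : Disjoint {ω | d ω = 1} {ω | d ω = 0} := by
    rw [Set.disjoint_left]
    intro ω (h : d ω = 1) (h' : d ω = 0)
    linarith
  have h : {ω | d ω = 1} ∪ {ω | d ω = 0} ∈ ae μ := by
    rw [mem_ae_iff_prob_eq_one (m1.union m0), measure_union hdis m0, h1, h0,
      ← ENNReal.ofReal_add hp0 (by linarith)]
    simp
  exact h

theorem integral_pow_of_zero_one [IsProbabilityMeasure μ] {d : Ω → ℝ} (hd : Measurable d)
    {p : ℝ} (hp0 : 0 ≤ p) (hp1 : p ≤ 1) (h1 : μ {ω | d ω = 1} = ENNReal.ofReal p)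
    (h0 : μ {ω | d ω = 0} = ENNReal.ofReal (1 - p)) {k : ℕ} (hk : k ≠ 0) :
    ∫ ω, d ω ^ k ∂μ = p := by
  have hae := ae_zero_or_one hd hp0 hp1 h1 h0
  have heq : (fun ω => d ω ^ k) =ᵐ[μ] Set.indicator {ω | d ω = 1} (fun _ => (1 : ℝ)) := by
    filter_upwards [hae] with ω hω
    rcases hω with hω | hω
    · rw [Set.indicator_of_mem (show ω ∈ {ω | d ω = 1} from hω), hω, one_pow]
    · have h3 : ω ∉ {ω | d ω = 1} := fun h : d ω = 1 => by linarith
      rw [Set.indicator_of_notMem h3, hω, zero_pow hk]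
  have m1 : MeasurableSet {ω | d ω = 1} := hd (measurableSet_singleton 1)
  rw [integral_congr_ae heq, integral_indicator_const _ m1]
  simp [Measure.real, h1, hp0]

theorem ae_norm_le_one_of_zero_one [IsProbabilityMeasure μ] {d : Ω → ℝ} (hd : Measurable d)
    {p : ℝ} (hp0 : 0 ≤ p) (hp1 : p ≤ 1) (h1 : μ {ω | d ω = 1} = ENNReal.ofReal p)
    (h0 : μ {ω | d ω = 0} = ENNReal.ofReal (1 - p)) : ∀ᵐ ω ∂μ, ‖d ω‖ ≤ 1 := by
  filter_upwards [ae_zero_or_one hd hp0 hp1 h1 h0] with ω hω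
  rcases hω with hω | hω <;> simp [hω]

/-- The entries of the random matrix on and above the diagonal. -/
noncomputable def entry {n : ℕ} (b : ℝ) (a d : Edge n → Ω → ℝ) (e : Edge n) (ω : Ω) : ℝ :=
  (Real.sqrt b)⁻¹ * a e ω * d e ω

variable {n : ℕ} {b v : ℝ} {ψ : ℝ → ℝ} {a d : Edge n → Ω → ℝ}

theorem IsEnsemble.measurable_entry (h : IsEnsemble b v ψ μ a d) (e : Edge n) :
    Measurable (entry b a d e) :=
  ((h.measurable_a e).const_mul _).mul (h.measurable_d e)

theorem IsEnsemble.map_entry [IsProbabilityMeasure μ] (h : IsEnsemble b v ψ μ a d) :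
    μ.map (fun ω e => entry b a d e ω) = Measure.pi fun e => μ.map (entry b a d e) := by
  refine (iIndepFun_iff_map_fun_eq_pi_map fun e => (h.measurable_entry e).aemeasurable).1 ?_
  exact iIndepFun_comp_prod (φ := fun q => (Real.sqrt b)⁻¹ * q.1 * q.2) h.measurable_a
    h.measurable_d h.indep (by fun_prop)

theorem IsEnsemble.integral_entry_pow [IsProbabilityMeasure μ] (hψ : IsProfile ψ)
    (h : IsEnsemble b v ψ μ a d) (e : Edge n) {k : ℕ} (hk : k ≠ 0) :
    ∫ y, y ^ k ∂(μ.map (entry b a d e)) =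
      (Real.sqrt b)⁻¹ ^ k * (∫ ω, a e ω ^ k ∂μ) * connProb ψ b e := by
  rw [integral_map (h.measurable_entry e).aemeasurable (by fun_prop)]
  have hI : IndepFun (a e) (d e) μ := by
    have := h.indep.indepFun (i := Sum.inl e) (j := Sum.inr e) (by simp)
    simpa using this
  simp only [entry, mul_pow, mul_assoc]
  rw [integral_const_mul, hI.integral_fun_comp_mul_comp (f := fun y => y ^ k)
    (g := fun y => y ^ k) (h.measurable_a e).aemeasurable (h.measurable_d e).aemeasurable
    (by fun_prop) (by fun_prop), integral_pow_of_zero_one (h.measurable_d e) (hψ.nonneg _)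
    (hψ.le_one _) (h.d_one e) (h.d_zero e) hk]
  rfl

theorem integrable_pow_six_of_absMomentSup_le [IsFiniteMeasure μ] {M : ℝ≥0}
    (ha : ∀ e, Measurable (a e)) (h : absMomentSup μ a 10 ≤ (M : ℝ≥0∞)) (e : Edge n) :
    Integrable (fun ω => a e ω ^ 6) μ := by
  have h10 : Integrable (fun ω => a e ω ^ 10) μ := by
    refine ⟨((ha e).pow_const 10).aestronglyMeasurable, ?_⟩
    rw [hasFiniteIntegral_iff_enorm]
    simp only [enorm_pow]
    exact ((le_iSup (fun e => ∫⁻ ω, ‖a e ω‖ₑ ^ 10 ∂μ) e).trans h).trans_lt ENNReal.coe_lt_top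
  refine ((integrable_const (1 : ℝ)).add h10.abs).mono'
    ((ha e).pow_const 6).aestronglyMeasurable (Filter.Eventually.of_forall fun ω => ?_)
  simp only [Pi.add_apply, Real.norm_eq_abs, abs_pow]
  rcases le_total |a e ω| 1 with h1 | h1
  · have := pow_le_one₀ (n := 6) (abs_nonneg _) h1
    have : 0 ≤ |a e ω| ^ 10 := by positivity
    linarith
  · have := pow_le_pow_right₀ h1 (by norm_num : 6 ≤ 10)
    linarith

/-- Since `d` is almost surely `0` or `1`, its positive powers all have mean `connProb ψ b e`. Thus
every moment of an entry is linear in the connection probability, as the summation along rows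
requires. -/
theorem IsEnsemble.momentData [IsProbabilityMeasure μ] (hψ : IsProfile ψ) (hb : 0 < b)
    (h : IsEnsemble b v ψ μ a d) (h3 : ∀ e, ∫ ω, a e ω ^ 3 ∂μ = 0)
    (h4 : ∀ e, ∫ ω, a e ω ^ 4 ∂μ = 3 * v ^ 4) (h6 : ∀ e, ∫ ω, a e ω ^ 6 ∂μ = 15 * v ^ 6)
    {M : ℝ≥0} (h10 : absMomentSup μ a 10 ≤ (M : ℝ≥0∞)) (e : Edge n) :
    MomentData (μ.map (entry b a d e)) (v ^ 2 * connProb ψ b e / b)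
      (3 * v ^ 4 * connProb ψ b e / b ^ 2) (15 * v ^ 6 * connProb ψ b e / b ^ 3) := by
  have hp0 : 0 ≤ connProb ψ b e := hψ.nonneg _
  have hp1 : connProb ψ b e ≤ 1 := hψ.le_one _
  have hs : (Real.sqrt b)⁻¹ ^ 2 = b⁻¹ := by rw [inv_pow, Real.sq_sqrt hb.le]
  have hs4 : (Real.sqrt b)⁻¹ ^ 4 = b⁻¹ ^ 2 := by rw [← hs]; ring
  have hs6 : (Real.sqrt b)⁻¹ ^ 6 = b⁻¹ ^ 3 := by rw [← hs]; ring
  constructor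
  · rw [integrable_map_measure (by fun_prop) (h.measurable_entry e).aemeasurable]
    have h1 := (integrable_pow_six_of_absMomentSup_le h.measurable_a h10 e).const_mul
      ((Real.sqrt b)⁻¹ ^ 6)
    refine h1.norm.mono' (((h.measurable_entry e).pow_const 6).aestronglyMeasurable) ?_
    filter_upwards [ae_norm_le_one_of_zero_one (h.measurable_d e) (hψ.nonneg _)
      (hψ.le_one _) (h.d_one e) (h.d_zero e)] with ω hω
    simp only [Function.comp_apply, entry, mul_pow, norm_mul]
    rw [norm_pow (d e ω)]
    exact mul_le_of_le_one_right (by positivity) (pow_le_one₀ (norm_nonneg _) hω)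
  · have := h.integral_entry_pow hψ e (k := 1) one_ne_zero
    simpa [h.mean_a] using this
  · rw [h.integral_entry_pow hψ e two_ne_zero, h.variance_a, hs]
    field_simp
  · rw [h.integral_entry_pow hψ e three_ne_zero, h3]
    ring
  · rw [h.integral_entry_pow hψ e four_ne_zero, h4, hs4]
    field_simp
  · rw [h.integral_entry_pow hψ e (by norm_num), h6, hs6]
    field_simp
  -- The required `v⁴ p² ≤ 3 v⁴ p` holds because `0 ≤ p ≤ 1`.
  · rw [div_pow, mul_pow, ← pow_mul, show 2 * 2 = 4 from rfl]
    have : connProb ψ b e ^ 2 ≤ connProb ψ b e := by nlinarith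
    have hv : 0 ≤ v ^ 4 := by positivity
    refine div_le_div_of_nonneg_right ?_ (sq_nonneg b)
    nlinarith [mul_le_mul_of_nonneg_left this hv, mul_nonneg hv hp0]

theorem resolvent_eq_green (b : ℝ) (a d : Edge n → Ω → ℝ) (z : ℂ) (ω : Ω) :
    resolvent b a d z ω = green z (fun e => entry b a d e ω) := by
  rw [resolvent, green]
  congr 2

theorem normTrace_eq_meanTrace (b : ℝ) (a d : Edge n → Ω → ℝ) (z : ℂ) (ω : Ω) :
    normTrace b a d z ω = meanTrace z (fun e => entry b a d e ω) := by
  simp only [normTrace, meanTrace, resolvent_eq_green]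

end Law

/-! ### Transfer from the probability space to the law of the entries, and conclusion -/

theorem centred_comp_eq {Ω α : Type*} [MeasurableSpace Ω] [MeasurableSpace α] {μ : Measure Ω}
    {X : Ω → α} (hX : Measurable X) {F : α → ℂ} (hF : BoundedMeasurable F) (ω : Ω) :
    centred μ (fun ω => F (X ω)) ω = F (X ω) - ∫ u, F u ∂(μ.map X) := by
  rw [centred, integral_map hX.aemeasurable hF.1.aestronglyMeasurable]

theorem cVar_comp {Ω α : Type*} [MeasurableSpace Ω] [MeasurableSpace α] {μ : Measure Ω}
    {X : Ω → α} (hX : Measurable X) {F : α → ℂ} (hF : BoundedMeasurable F) :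
    cVar μ (fun ω => F (X ω)) = ∫ x, ‖F x - ∫ u, F u ∂(μ.map X)‖ ^ 2 ∂(μ.map X) := by
  simp only [cVar, centred_comp_eq hX hF]
  exact (integral_map hX.aemeasurable
    (((hF.1.sub_const _).norm.pow_const 2).aestronglyMeasurable)).symm

/-- Centring the second factor changes nothing, because the first already has mean zero. -/
theorem integral_centred_mul_centred_comp {Ω α : Type*} [MeasurableSpace Ω] [MeasurableSpace α]
    {μ : Measure Ω} [IsProbabilityMeasure μ] {X : Ω → α} (hX : Measurable X) {F G : α → ℂ}
    (hF : BoundedMeasurable F) (hG : BoundedMeasurable G) :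
    ∫ ω, centred μ (fun ω => F (X ω)) ω * centred μ (fun ω => G (X ω)) ω ∂μ =
      ∫ x, (F x - ∫ u, F u ∂(μ.map X)) * G x ∂(μ.map X) := by
  have := Measure.isProbabilityMeasure_map (μ := μ) hX.aemeasurable
  simp only [centred_comp_eq hX hF, centred_comp_eq hX hG]
  set m := ∫ u, F u ∂(μ.map X)
  set c := ∫ u, G u ∂(μ.map X)
  have hFm : BoundedMeasurable fun x => F x - m := hF.sub (.const m)
  have h0 : ∫ x, (F x - m) ∂(μ.map X) = 0 := by
    rw [integral_sub hF.integrable (integrable_const m)]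
    simp [m]
  rw [← integral_map hX.aemeasurable (f := fun x => (F x - m) * (G x - c))
    ((hF.1.sub_const m).mul (hG.1.sub_const c)).aestronglyMeasurable]
  simp only [mul_sub]
  rw [integral_sub (hFm.mul hG).integrable (hFm.integrable.mul_const c), integral_mul_const, h0,
    zero_mul, sub_zero]

end LongRangePercolation

theorem theorem5p2 (v : ℝ) (hv : 0 ≤ v) (ψ : ℝ → ℝ) (hψ : LongRangePercolation.IsProfile ψ)
    (hsqrt : Integrable (fun t : ℝ => Real.sqrt (ψ t))) (M : ℝ≥0) :
    ∃ (C : ℝ) (n₀ : ℕ) (b₀ : ℝ), ∀ (n : ℕ) (b : ℝ), n₀ ≤ n → b₀ ≤ b → 0 < n → 0 < b →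
      b ≤ 2 * (n : ℝ) + 1 →
      ∀ (Ω : Type*) [MeasurableSpace Ω] (μ : Measure Ω) [IsProbabilityMeasure μ]
        (a d : LongRangePercolation.Edge n → Ω → ℝ),
        LongRangePercolation.IsEnsemble b v ψ μ a d →
        (∀ e, ∫ ω, a e ω ^ 3 ∂μ = 0) →
        (∀ e, ∫ ω, a e ω ^ 5 ∂μ = 0) →
        (∀ e, ∫ ω, a e ω ^ 4 ∂μ = 3 * v ^ 4) →
        (∀ e, ∫ ω, a e ω ^ 6 ∂μ = 15 * v ^ 6) →
        LongRangePercolation.absMomentSup μ a 10 ≤ (M : ℝ≥0∞) →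
        ∀ z : ℂ, 2 * v + 1 ≤ |z.im| →
          (⨆ i : LongRangePercolation.Site n,
              ‖∫ ω, LongRangePercolation.centred μ (LongRangePercolation.normTrace b a d z) ω *
                LongRangePercolation.centred μ
                  (fun ω' => LongRangePercolation.resolvent b a d z ω' i i) ω ∂μ‖) ≤
            C * (1 / ((n : ℝ) * b) + 1 / b *
              Real.sqrt (LongRangePercolation.cVar μ (LongRangePercolation.normTrace b a d z))) ∧
          LongRangePercolation.cVar μ (LongRangePercolation.normTrace b a d z) ≤ C / b ^ 2 := by
  have hA0 : 0 ≤ 8 * v ^ 2 + 120000 * (3 * v ^ 4 + 15 * v ^ 6) := by positivity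
  have hB0 : 0 ≤ 2 * (2 * v ^ 2 + 12 * v ^ 4 * (7 * 288 ^ 2) +
      v ^ 2 * Real.sqrt (2 * (8 * v ^ 2 + 120000 * (3 * v ^ 4 + 15 * v ^ 6)))) := by positivity
  -- The constant is the sum of the variance constant and the covariance constant. The threshold `1
  -- + 8 * v ^ 2` ensures both `1 ≤ b` and `8 * v ^ 2 ≤ b`, the latter making every entry variance
  -- at most `1 / 8`.
  refine ⟨(8 * v ^ 2 + 120000 * (3 * v ^ 4 + 15 * v ^ 6)) +
    2 * (2 * v ^ 2 + 12 * v ^ 4 * (7 * 288 ^ 2) +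
      v ^ 2 * Real.sqrt (2 * (8 * v ^ 2 + 120000 * (3 * v ^ 4 + 15 * v ^ 6)))), 0, 1 + 8 * v ^ 2,
    fun n b _ hb hn hb0 hbn Ω _ μ _ a d h h3 _ h4 h6 h10 z hz => ?_⟩
  have hv2 : 0 ≤ v ^ 2 := sq_nonneg v
  have hb1 : 1 ≤ b := by linarith
  have hbv : 8 * v ^ 2 ≤ b := by linarith
  have hz1 : 1 ≤ |z.im| := by linarith
  have hn0 : (0 : ℝ) < n := Nat.cast_pos.2 hn
  have hX : Measurable fun ω (e : LongRangePercolation.Edge n) =>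
      LongRangePercolation.entry b a d e ω :=
    measurable_pi_iff.2 fun e => h.measurable_entry e
  have hprob (e : LongRangePercolation.Edge n) :
      IsProbabilityMeasure (μ.map (LongRangePercolation.entry b a d e)) :=
    Measure.isProbabilityMeasure_map (h.measurable_entry e).aemeasurable
  have hT := LongRangePercolation.boundedMeasurable_meanTrace (n := n) hz1
  have hg : LongRangePercolation.normTrace b a d z = fun ω =>
      LongRangePercolation.meanTrace z fun e => LongRangePercolation.entry b a d e ω :=
    funext fun ω => LongRangePercolation.normTrace_eq_meanTrace b a d z ω
  have hV := LongRangePercolation.cVar_comp (μ := μ) hX hT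
  rw [← hg, h.map_entry] at hV
  have hmom := h.momentData hψ hb0 h3 h4 h6 h10
  have hp0 (e : LongRangePercolation.Edge n) : 0 ≤ LongRangePercolation.connProb ψ b e :=
    hψ.nonneg _
  have hp1 (e : LongRangePercolation.Edge n) : LongRangePercolation.connProb ψ b e ≤ 1 :=
    hψ.le_one _
  have hp := LongRangePercolation.sum_connProb_le (n := n) hψ hb0
  have hvar := LongRangePercolation.variance_meanTrace_le _ hz1 hb1 hbv hp0 hp1 hp hmom
  rw [← hV] at hvar
  set A := 8 * v ^ 2 + 120000 * (3 * v ^ 4 + 15 * v ^ 6)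
  set B := 2 * (2 * v ^ 2 + 12 * v ^ 4 * (7 * 288 ^ 2) + v ^ 2 * Real.sqrt (2 * A))
  set V := LongRangePercolation.cVar μ (LongRangePercolation.normTrace b a d z)
  constructor
  · have : Nonempty (LongRangePercolation.Site n) := ⟨⟨0, Finset.mem_Icc.2 (by omega)⟩⟩
    refine ciSup_le fun i => ?_
    have hcov := LongRangePercolation.norm_integral_meanTrace_mul_green_le _ hv hz hb1 hbv hp0 hp1
      hp hmom i hV.symm
    have hG := LongRangePercolation.boundedMeasurable_green hz1 i i
    have heq := LongRangePercolation.integral_centred_mul_centred_comp (μ := μ) hX hT hG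
    rw [h.map_entry] at heq
    simp only [LongRangePercolation.resolvent_eq_green, hg]
    rw [heq]
    refine hcov.trans ?_
    have hinv : (2 * (n : ℝ) + 1)⁻¹ ≤ 1 / n := by
      rw [← one_div]
      exact one_div_le_one_div_of_le hn0 (by linarith)
    calc B / b * (√V + (2 * (n : ℝ) + 1)⁻¹) ≤ B / b * (√V + 1 / n) := by gcongr
      _ = B * (1 / (n * b) + 1 / b * √V) := by field_simp; ring
      _ ≤ (A + B) * (1 / (n * b) + 1 / b * √V) := by
        gcongr
        linarith
  · refine hvar.trans ?_
    -- The bandwidth does not exceed the dimension, so `1 / (b N) ≤ 1 / b ^ 2`.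
    calc A / b * (2 * (n : ℝ) + 1)⁻¹ ≤ A / b * b⁻¹ := by gcongr
      _ = A / b ^ 2 := by field_simp
      _ ≤ (A + B) / b ^ 2 := by
        gcongr
        linarith
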